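/- Let $X$ be a complex, separable, infinite-dimensional Banach space and $T$ a bounded linear operator on $X$. Call $v\in X$ *hypercyclic* for $T$ if $\{T^nv : n\ge 0\}$ is dense in $X$, and *frequently hypercyclic* for $T$ if for every non-empty open $U\subseteq X$ the set $A=\{n\ge 0 : T^nv\in U\}$ has positive lower density, i.e. $\liminf_{N\to\infty}\frac1N\#(A\cap[0,N))>0$; $T$ is called hypercyclic (frequently hypercyclic) if it has such a vector. Assume that $T$ is hypercyclic and satisfies the following assumption (H): there is a sequence $(x_n)_{n\ge1}$ of eigenvectors of $T$ with $\|x_n\|=1$, $Tx_n=\lambda_nx_n$, $\lambda_n=e^{2i\pi\theta_n}$, $\theta_n\in(0,1]$, such that 1. whenever $\lambda_{n_1},\dots,\lambda_{n_k}$ are distinct, the numbers $\theta_{n_1},\dots,\theta_{n_k}$ are irrational and linearly independent over $\mathbb Q$; 2. the linear span of $\{x_n : n\ge1\}$ is dense in $X$; 3. for every finite set $F$ of eigenvalues of $T$ of modulus $1$, $\overline{\{x_n : n\ge1\}}=\overline{\{x_n : n\ge 1,\ \lambda_n\notin F\}}$. Then $T$ is frequently hypercyclic. Moreover, there is a sequence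 $(y_n)_{n\ge1}$ of eigenvectors of $T$ with eigenvalues of modulus $1$ such that, for every sequence $(\chi_n)_{n\ge1}$ of independent random variables uniformly distributed on the unit circle (Steinhaus variables) on a probability space $(\Omega,\mathcal F,\mathbb P)$, the series $\Phi=\sum_{n\ge1}\chi_ny_n$ converges almost surely in $X$, and the law $m$ of $\Phi$ on $X$ is $T$-invariant, with $m$-almost every vector of $X$ hypercyclic for $T$. -/

import Mathlib

open MeasureTheory ProbabilityTheory Filter Topology

noncomputable section

namespace LinDyn

variable {X : Type*} [NormedAddCommGroup X] [NormedSpace ℂ X]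

/-- `x` is a hypercyclic vector for `T`: its orbit `{T ^ n x ; n ≥ 0}` is dense. -/
def IsHypercyclicVector (T : X →L[ℂ] X) (x : X) : Prop :=
  Dense (Set.range fun n : ℕ => (T ^ n) x)

/-- `T` is hypercyclic: it has a hypercyclic vector. -/
def IsHypercyclic (T : X →L[ℂ] X) : Prop :=
  ∃ x : X, IsHypercyclicVector T x

/-- The lower density `liminf_N #{n < N ; n ∈ A} / N` of a set of natural numbers. -/
def lowerDensity (A : Set ℕ) : ℝ :=
  liminf (fun N : ℕ => ((A ∩ Set.Iio N).ncard : ℝ) / N) atTop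

/-- `x` is a frequently hypercyclic vector for `T`: the orbit of `x` visits every non-empty
open set along a set of times of positive lower density. -/
def IsFreqHypercyclicVector (T : X →L[ℂ] X) (x : X) : Prop :=
  ∀ U : Set X, IsOpen U → U.Nonempty → 0 < lowerDensity {n : ℕ | (T ^ n) x ∈ U}

/-- `T` is frequently hypercyclic: it has a frequently hypercyclic vector. -/
def IsFreqHypercyclic (T : X →L[ℂ] X) : Prop :=
  ∃ x : X, IsFreqHypercyclicVector T x

/-- `v` is an eigenvector of `T` (in particular `v ≠ 0`) with eigenvalue `μ` of modulus one. -/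
def IsUnimodularEigenvector (T : X →L[ℂ] X) (μ : ℂ) (v : X) : Prop :=
  ‖μ‖ = 1 ∧ Module.End.HasEigenvector (T : X →ₗ[ℂ] X) μ v

/-- The set of eigenvalues of `T` of modulus one. -/
def unimodularPointSpectrum (T : X →L[ℂ] X) : Set ℂ :=
  {μ : ℂ | ‖μ‖ = 1 ∧ Module.End.HasEigenvalue (T : X →ₗ[ℂ] X) μ}

/-- Assumption (H) on `T`, for a given sequence `x n` of vectors with `T (x n) = lam n • x n`
and `lam n = exp (2 π i θ n)`. -/
structure SatisfiesHWith (T : X →L[ℂ] X) (x : ℕ → X) (lam : ℕ → ℂ) (θ : ℕ → ℝ) : Prop where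
  eigenvector : ∀ n, IsUnimodularEigenvector T (lam n) (x n)
  norm_one : ∀ n, ‖x n‖ = 1
  arg_mem : ∀ n, θ n ∈ Set.Ioc (0 : ℝ) 1
  eigenvalue_eq : ∀ n, lam n = Complex.exp (2 * Real.pi * Complex.I * θ n)
  /-- Any finite family of distinct eigenvalues `lam n` has arguments `θ n` which are irrational
  and linearly independent over the rationals. -/
  independent : ∀ s : Finset ℕ, Set.InjOn lam s →
    (∀ n ∈ s, Irrational (θ n)) ∧ LinearIndependent ℚ (fun n : s => θ n)
  spanning : Dense (Submodule.span ℂ (Set.range x) : Set X)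
  approx : ∀ F : Set ℂ, F.Finite → F ⊆ unimodularPointSpectrum T →
    closure (Set.range x) = closure (x '' {n | lam n ∉ F})

/-- Assumption (H): `T` admits a sequence of eigenvectors as above. -/
def SatisfiesH (T : X →L[ℂ] X) : Prop :=
  ∃ (x : ℕ → X) (lam : ℕ → ℂ) (θ : ℕ → ℝ), SatisfiesHWith T x lam θ

/-- The uniform probability measure on the unit circle of `ℂ`, i.e. normalized arc length: the
image of Lebesgue measure on `(0, 1]` under `t ↦ exp (2 π i t)`. -/
def uniformCircle : Measure ℂ :=
  (volume.restrict (Set.Ioc (0 : ℝ) 1)).map fun t : ℝ => Complex.exp (2 * Real.pi * Complex.I * t)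

/-- `χ` is a sequence of independent Steinhaus variables, i.e. of independent random variables
with values in the unit circle which are uniformly distributed on the unit circle. -/
structure IsSteinhausSequence {Ω : Type*} [MeasurableSpace Ω] (P : Measure Ω)
    (χ : ℕ → Ω → ℂ) : Prop where
  measurable : ∀ n, Measurable (χ n)
  norm_eq_one : ∀ n ω, ‖χ n ω‖ = 1
  law : ∀ n, P.map (χ n) = uniformCircle
  indep : iIndepFun χ P

end LinDyn

end

/-!
The random vector of the theorem is `Φ = ∑ n, χ n • y n`, where the `y n` are eigenvectors of `T`
with distinct unimodular eigenvalues `μ n`. Since the law of a sequence of independent Steinhaus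
variables is the product measure `steinhausLaw`, everything takes place on `ℕ → ℂ` with that
measure.

*Invariance.* `T` acts on `Φ` by replacing `χ n` by `μ n * χ n`, which does not change the law of
the variables (`measurePreserving_law`).

*Hypercyclicity* (`ae_exists_norm_pow_sub_lt`). If `1` and the arguments of the `μ n` are
rationally independent, Kronecker's theorem (`exists_pow_mul_near`, through Weyl equidistribution
on the torus) gives a time `n` at which the first `K` coefficients `μ j ^ n * χ j` are close to
prescribed unimodular numbers `c j`. The choice of `n` depends on the first `K` variables only,
so by independence the remainder of `T ^ n Φ` has the law of the remainder of `Φ`, which is small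
with large probability. Hence almost every orbit visits each ball, as soon as the sums `∑ j < K,
c j • y j` with unimodular `c` come close to every vector for arbitrarily large `K`.

*Construction of the `y n`* (`SatisfiesHWith.exists_series`). A multiple `b • x i` is replaced by
`N` vectors `(‖b‖ * a l) • x (g l)` with `∑ a l = 1`, where the `x (g l)` are close to `x i` and
have eigenvalues that were not used before. With all phases aligned these vectors add up to about
`b • x i`, while with random phases even the largest partial sum is small in mean for suitable
weights `a l` (`exists_weights`, `meanMaximal_run_le`). As the `x i` span a dense subspace, every
vector can be reached by such blocks (`SatisfiesHWith.blockApproximable`), and the `k`-th block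
is chosen to correct the sum of the preceding ones into the `k`-th target of a dense sequence.
The arguments in (H) are rationally independent, but `1` may be a rational combination of them;
avoiding the finitely many eigenvalues in one such relation restores independence with `1`
(`SatisfiesHWith.exists_finite_independent`).

*Frequent hypercyclicity* (`ae_isFreqHypercyclicVector`). For an invariant probability measure
almost every point of an open set returns to it with positive lower density
(`ae_mem_imp_exists_le_mul_visits`), and almost every orbit meets every open set.
-/

noncomputable section

namespace LinDyn

/-! ### Steinhaus variables -/

lemma uniformCircle_eq_map :
    uniformCircle =
      (volume : Measure UnitAddCircle).map fun x => (AddCircle.toCircle x : ℂ) := by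
  have h := AddCircle.measurePreserving_mk (1 : ℝ) 0
  have hc : Measurable fun x : UnitAddCircle => (AddCircle.toCircle x : ℂ) :=
    (continuous_subtype_val.comp AddCircle.continuous_toCircle).measurable
  rw [← h.map_eq, Measure.map_map hc h.measurable, uniformCircle, zero_add]
  congr 1
  ext t
  simp only [Function.comp, AddCircle.toCircle_apply_mk, Circle.coe_exp]
  congr 1
  push_cast
  ring

instance : IsProbabilityMeasure uniformCircle := by
  have : IsProbabilityMeasure (volume.restrict (Set.Ioc (0 : ℝ) 1)) := ⟨by simp⟩
  exact Measure.isProbabilityMeasure_map (by fun_prop)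

lemma uniformCircle_ae_norm : ∀ᵐ z ∂uniformCircle, ‖z‖ = 1 := by
  rw [uniformCircle, ae_map_iff (by fun_prop) (measurableSet_eq_fun (by fun_prop) (by fun_prop))]
  refine Eventually.of_forall fun t => ?_
  rw [Complex.norm_exp]
  simp

lemma exists_toCircle_eq {c : ℂ} (hc : ‖c‖ = 1) :
    ∃ s : UnitAddCircle, (AddCircle.toCircle s : ℂ) = c := by
  obtain ⟨s, hs⟩ := (AddCircle.homeomorphCircle (one_ne_zero' ℝ)).surjective
    ⟨c, by simpa [Submonoid.unitSphere] using hc⟩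
  refine ⟨s, ?_⟩
  rw [← AddCircle.homeomorphCircle_apply (one_ne_zero' ℝ), hs]

lemma uniformCircle_map_mul {c : ℂ} (hc : ‖c‖ = 1) :
    uniformCircle.map (fun z => c * z) = uniformCircle := by
  obtain ⟨s, hs⟩ := exists_toCircle_eq hc
  have hm : Measurable fun x : UnitAddCircle => (AddCircle.toCircle x : ℂ) :=
    (continuous_subtype_val.comp AddCircle.continuous_toCircle).measurable
  rw [uniformCircle_eq_map, Measure.map_map (by fun_prop) hm]
  conv_rhs => rw [← (measurePreserving_add_left (volume : Measure UnitAddCircle) s).map_eq,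
    Measure.map_map hm (by fun_prop)]
  congr 1
  ext x
  simp [AddCircle.toCircle_add, hs]

/-- The law of a sequence of independent Steinhaus variables. -/
def steinhausLaw : Measure (ℕ → ℂ) := Measure.infinitePi fun _ => uniformCircle

instance : IsProbabilityMeasure steinhausLaw := by
  unfold steinhausLaw; infer_instance

lemma IsSteinhausSequence.map_eq {Ω : Type*} [MeasurableSpace Ω] {P : Measure Ω}
    {χ : ℕ → Ω → ℂ} (h : IsSteinhausSequence P χ) :
    P.map (fun ω n => χ n ω) = steinhausLaw := by
  rw [h.indep.map_fun_eq_infinitePi_map h.measurable, steinhausLaw]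
  simp_rw [h.law]

lemma steinhausLaw_ae_norm : ∀ᵐ z ∂steinhausLaw, ∀ n, ‖z n‖ = 1 := by
  rw [ae_all_iff]
  intro n
  exact (measurePreserving_eval_infinitePi (fun _ : ℕ => uniformCircle) n).quasiMeasurePreserving.ae
    uniformCircle_ae_norm

lemma measurePreserving_rotate {c : ℕ → ℂ} (hc : ∀ n, ‖c n‖ = 1) :
    MeasurePreserving (fun (z : ℕ → ℂ) n => c n * z n) steinhausLaw steinhausLaw := by
  refine ⟨by fun_prop, ?_⟩
  have h := Measure.infinitePi_map_pi (fun _ : ℕ => uniformCircle)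
    (f := fun n z => c n * z) (fun n => by fun_prop)
  simp_rw [uniformCircle_map_mul (hc _)] at h
  exact h

lemma measurePreserving_shift (k : ℕ) :
    MeasurePreserving (fun (z : ℕ → ℂ) n => z (k + n)) steinhausLaw steinhausLaw := by
  refine ⟨by fun_prop, ?_⟩
  exact Measure.map_infinitePi_infinitePi_of_inj (P := fun _ : ℕ => uniformCircle)
    (add_right_injective k)

/-- Distinct coordinates are orthogonal: rotating one of them by `-1` preserves the law and
changes the sign of the integral. -/
lemma integral_mul_conj_steinhausLaw {i j : ℕ} (hij : i ≠ j) :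
    ∫ z, z i * (starRingEnd ℂ) (z j) ∂steinhausLaw = 0 := by
  set c : ℕ → ℂ := fun n => if n = i then -1 else 1 with hcdef
  have hc : ∀ n, ‖c n‖ = 1 := fun n => by by_cases h : n = i <;> simp [hcdef, h]
  have hmp := measurePreserving_rotate hc
  have h := integral_map (μ := steinhausLaw) hmp.measurable.aemeasurable
    (f := fun z : ℕ → ℂ => z i * (starRingEnd ℂ) (z j))
    (by rw [hmp.map_eq]; exact (Continuous.aestronglyMeasurable (by fun_prop)))
  rw [hmp.map_eq] at h
  simp only [hcdef, if_true, if_neg hij.symm, one_mul, neg_mul, integral_neg] at h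
  exact CharZero.eq_neg_self_iff.mp h

lemma integrable_mul_conj_steinhausLaw (i j : ℕ) :
    Integrable (fun z => z i * (starRingEnd ℂ) (z j)) steinhausLaw := by
  refine Integrable.of_bound (C := 1) (Continuous.aestronglyMeasurable (by fun_prop)) ?_
  filter_upwards [steinhausLaw_ae_norm] with z hz
  simp [hz]

lemma integral_normSq_sum_steinhausLaw (a : ℕ → ℝ) (m : ℕ) :
    ∫ z, ‖∑ l ∈ Finset.range m, z l * (a l : ℂ)‖ ^ 2 ∂steinhausLaw
      = ∑ l ∈ Finset.range m, a l ^ 2 := by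
  have key : ∫ z, ((‖∑ l ∈ Finset.range m, z l * (a l : ℂ)‖ ^ 2 : ℝ) : ℂ) ∂steinhausLaw
      = ((∑ l ∈ Finset.range m, a l ^ 2 : ℝ) : ℂ) := by
    have hexp : ∀ z : ℕ → ℂ, ((‖∑ l ∈ Finset.range m, z l * (a l : ℂ)‖ ^ 2 : ℝ) : ℂ) =
        ∑ i ∈ Finset.range m, ∑ j ∈ Finset.range m,
          ((a i : ℂ) * a j) * (z i * (starRingEnd ℂ) (z j)) := by
      intro z
      rw [Complex.ofReal_pow, ← Complex.mul_conj', map_sum, Finset.sum_mul_sum]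
      refine Finset.sum_congr rfl fun i _ => Finset.sum_congr rfl fun j _ => ?_
      rw [map_mul, Complex.conj_ofReal]; ring
    simp_rw [hexp]
    rw [integral_finsetSum _ fun i _ => integrable_finsetSum _ fun j _ =>
      (integrable_mul_conj_steinhausLaw i j).const_mul _]
    push_cast
    refine Finset.sum_congr rfl fun i hi => ?_
    rw [integral_finsetSum _ fun j _ => (integrable_mul_conj_steinhausLaw i j).const_mul _,
      Finset.sum_eq_single i]
    · rw [integral_const_mul]
      have : ∫ z, z i * (starRingEnd ℂ) (z i) ∂steinhausLaw = 1 := by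
        rw [integral_congr_ae (g := fun _ => (1 : ℂ))]
        · simp
        · filter_upwards [steinhausLaw_ae_norm] with z hz
          rw [Complex.mul_conj', hz]; simp
      rw [this]; ring
    · intro j _ hj
      rw [integral_const_mul, integral_mul_conj_steinhausLaw hj.symm, mul_zero]
    · intro h; exact absurd hi h
  rw [integral_complex_ofReal] at key
  exact_mod_cast key

/-! ### Kronecker's theorem -/

section Kronecker

variable {ι : Type*} [Fintype ι]

lemma fourier_coe_real (n : ℤ) (t : ℝ) :
    fourier n (t : UnitAddCircle) = Complex.exp (2 * Real.pi * Complex.I * (n * t)) := by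
  rw [fourier_coe_apply]
  congr 1
  push_cast
  ring

lemma mFourier_coe_real (m : ι → ℤ) (θ : ι → ℝ) :
    UnitAddTorus.mFourier m (fun i => (θ i : UnitAddCircle)) =
      Complex.exp (2 * Real.pi * Complex.I * ((∑ i, m i * θ i : ℝ) : ℂ)) := by
  simp only [UnitAddTorus.mFourier, ContinuousMap.coe_mk, fourier_coe_real]
  rw [← Complex.exp_sum, ← Finset.mul_sum]
  push_cast
  rfl

lemma mFourier_add_apply (m : ι → ℤ) (x y : UnitAddTorus ι) :
    UnitAddTorus.mFourier m (x + y) =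
      UnitAddTorus.mFourier m x * UnitAddTorus.mFourier m y := by
  simp only [UnitAddTorus.mFourier, ContinuousMap.coe_mk, Pi.add_apply, fourier_apply, smul_add,
    AddCircle.toCircle_add, Circle.coe_mul, Finset.prod_mul_distrib]

lemma mFourier_nsmul_apply (m : ι → ℤ) (x : UnitAddTorus ι) (k : ℕ) :
    UnitAddTorus.mFourier m (k • x) = UnitAddTorus.mFourier m x ^ k := by
  induction k with
  | zero =>
    simp [UnitAddTorus.mFourier]
  | succ k ih => rw [succ_nsmul, mFourier_add_apply, ih, pow_succ]

lemma tendsto_average_geometric {q : ℂ} (hq : ‖q‖ = 1) (h1 : q ≠ 1) :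
    Tendsto (fun N : ℕ => (N : ℂ)⁻¹ * ∑ k ∈ Finset.range N, q ^ k) atTop (𝓝 0) := by
  rw [tendsto_zero_iff_norm_tendsto_zero]
  have hlim : Tendsto (fun N : ℕ => (2 / ‖q - 1‖) * (N : ℝ)⁻¹) atTop (𝓝 0) := by
    simpa using tendsto_inv_atTop_nhds_zero_nat.const_mul (2 / ‖q - 1‖)
  refine squeeze_zero (fun _ => norm_nonneg _) (fun N => ?_) hlim
  rw [geom_sum_eq h1, norm_mul, norm_inv, norm_div, Complex.norm_natCast, mul_comm]
  gcongr
  calc ‖q ^ N - 1‖ ≤ ‖q ^ N‖ + ‖(1 : ℂ)‖ := norm_sub_le _ _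
    _ = 2 := by rw [norm_pow, hq]; norm_num

/-- Weyl's equidistribution theorem for a rotation of the torus, in the form of the convergence of
time averages to the space average. -/
lemma tendsto_average_rotation {θ : ι → ℝ}
    (hθ : ∀ (m : ι → ℤ) (k : ℤ), ∑ i, m i * θ i = k → m = 0)
    (x : UnitAddTorus ι) (f : C(UnitAddTorus ι, ℂ)) :
    Tendsto (fun N : ℕ => (N : ℂ)⁻¹ *
      ∑ k ∈ Finset.range N, f (x + k • fun i => (θ i : UnitAddCircle))) atTop
      (𝓝 (∫ y, f y ∂(volume : Measure (ι → UnitAddCircle)))) := by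
  set ϑ : UnitAddTorus ι := fun i => (θ i : UnitAddCircle) with hϑ
  set vol : Measure (ι → UnitAddCircle) := volume with hvol
  have : IsProbabilityMeasure vol := by
    refine ⟨?_⟩
    rw [hvol, volume_pi, Measure.pi_univ]
    simp
  have hint : ∀ f : C(UnitAddTorus ι, ℂ), Integrable (fun y => f y) vol := fun f =>
    Integrable.of_bound f.continuous.aestronglyMeasurable ‖f‖
      (Eventually.of_forall f.norm_coe_le_norm)
  -- the discrepancy after `N` steps, a linear functional of norm at most `2`
  let D : ℕ → C(UnitAddTorus ι, ℂ) → ℂ := fun N f =>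
    (N : ℂ)⁻¹ * ∑ k ∈ Finset.range N, f (x + k • ϑ) - ∫ y, f y ∂vol
  have hDadd : ∀ N f g, D N (f + g) = D N f + D N g := by
    intro N f g
    simp only [D, ContinuousMap.add_apply, Finset.sum_add_distrib]
    rw [integral_add (hint f) (hint g)]
    ring
  have hDsmul : ∀ N (c : ℂ) f, D N (c • f) = c * D N f := by
    intro N c f
    simp only [D, ContinuousMap.smul_apply, smul_eq_mul, ← Finset.mul_sum]
    rw [integral_const_mul]
    ring
  have hDnorm : ∀ N f, ‖D N f‖ ≤ 2 * ‖f‖ := by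
    intro N f
    have h1 : ‖(N : ℂ)⁻¹ * ∑ k ∈ Finset.range N, f (x + k • ϑ)‖ ≤ ‖f‖ := by
      rcases Nat.eq_zero_or_pos N with rfl | hN
      · simp
      · rw [norm_mul, norm_inv, Complex.norm_natCast, inv_mul_le_iff₀ (by exact_mod_cast hN)]
        refine (norm_sum_le _ _).trans ?_
        refine (Finset.sum_le_sum fun k _ => f.norm_coe_le_norm _).trans ?_
        simp
    have h2 : ‖∫ y, f y ∂vol‖ ≤ ‖f‖ := by
      have := norm_integral_le_of_norm_le_const (μ := vol) (f := fun y => f y) (C := ‖f‖)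
        (Eventually.of_forall f.norm_coe_le_norm)
      simpa using this
    calc ‖D N f‖ ≤ _ := norm_sub_le _ _
      _ ≤ 2 * ‖f‖ := by linarith
  have hmono : ∀ m : ι → ℤ, Tendsto (fun N => D N (UnitAddTorus.mFourier m)) atTop (𝓝 0) := by
    intro m
    by_cases hm : m = 0
    · subst hm
      refine tendsto_const_nhds.congr' ?_
      filter_upwards [eventually_gt_atTop 0] with N hN
      have hN' : (N : ℂ) ≠ 0 := by exact_mod_cast hN.ne'
      simp [D, UnitAddTorus.mFourier_zero, hN']
    · have hq1 : UnitAddTorus.mFourier m ϑ ≠ 1 := by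
        rw [hϑ, mFourier_coe_real, Ne, Complex.exp_eq_one_iff]
        rintro ⟨k, hk⟩
        refine hm (hθ m k ?_)
        have h2 : (2 * Real.pi * Complex.I : ℂ) ≠ 0 := Complex.two_pi_I_ne_zero
        have h3 : ((∑ i, m i * θ i : ℝ) : ℂ) = k := by
          apply mul_left_cancel₀ h2
          rw [hk]; ring
        exact_mod_cast h3
      have hqn : ‖UnitAddTorus.mFourier m ϑ‖ = 1 := by
        rw [hϑ, mFourier_coe_real, Complex.norm_exp]
        simp
      have hI : ∫ y, UnitAddTorus.mFourier m y ∂vol = 0 := by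
        have h := integral_add_left_eq_self (μ := vol) (fun y => UnitAddTorus.mFourier m y) ϑ
        simp_rw [mFourier_add_apply] at h
        rw [integral_const_mul] at h
        have h' : (UnitAddTorus.mFourier m ϑ - 1) * ∫ y, UnitAddTorus.mFourier m y ∂vol = 0 := by
          rw [sub_mul, one_mul, h, sub_self]
        exact (mul_eq_zero.mp h').resolve_left (sub_ne_zero.mpr hq1)
      have hlim := (tendsto_average_geometric hqn hq1).const_mul (UnitAddTorus.mFourier m x)
      rw [mul_zero] at hlim
      refine hlim.congr fun N => ?_
      simp only [D, hI, sub_zero, mFourier_add_apply, mFourier_nsmul_apply, ← Finset.mul_sum]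
      ring
  have hspan : ∀ g ∈ Submodule.span ℂ (Set.range (UnitAddTorus.mFourier (d := ι))),
      Tendsto (fun N => D N g) atTop (𝓝 0) := by
    intro g hg
    induction hg using Submodule.span_induction with
    | mem g hg => obtain ⟨m, rfl⟩ := hg; exact hmono m
    | zero =>
      refine tendsto_const_nhds.congr fun N => ?_
      simp [D]
    | add g h _ _ hg hh =>
      simp_rw [hDadd]
      simpa using hg.add hh
    | smul c g _ hg =>
      simp_rw [hDsmul]
      simpa using hg.const_mul c
  have hD : Tendsto (fun N => D N f) atTop (𝓝 0) := by
    rw [Metric.tendsto_atTop]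
    intro ε hε
    have hf : f ∈ closure (Submodule.span ℂ (Set.range (UnitAddTorus.mFourier (d := ι))) :
        Set C(UnitAddTorus ι, ℂ)) := by
      rw [← Submodule.topologicalClosure_coe, UnitAddTorus.span_mFourier_closure_eq_top]
      trivial
    obtain ⟨g, hg, hfg⟩ := Metric.mem_closure_iff.mp hf (ε / 4) (by positivity)
    obtain ⟨N₀, hN₀⟩ := Metric.tendsto_atTop.mp (hspan g hg) (ε / 2) (by positivity)
    refine ⟨N₀, fun N hN => ?_⟩
    have h1 := hN₀ N hN
    rw [dist_zero_right] at h1 ⊢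
    have h2 : D N f = D N (f - g) + D N g := by rw [← hDadd, sub_add_cancel]
    have h3 := hDnorm N (f - g)
    rw [dist_eq_norm] at hfg
    calc ‖D N f‖ ≤ ‖D N (f - g)‖ + ‖D N g‖ := by rw [h2]; exact norm_add_le _ _
      _ < ε := by linarith
  simpa [D] using hD.add_const (∫ y, f y ∂vol)

/-- Kronecker's theorem: if `1` and the `θ i` are rationally independent, every forward orbit of
the rotation by `θ` is dense in the torus. -/
lemma exists_nsmul_mem_of_isOpen {θ : ι → ℝ}
    (hθ : ∀ (m : ι → ℤ) (k : ℤ), ∑ i, m i * θ i = k → m = 0)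
    (x : UnitAddTorus ι) {V : Set (UnitAddTorus ι)} (hV : IsOpen V) (hne : V.Nonempty) :
    ∃ n : ℕ, x + n • (fun i => (θ i : UnitAddCircle)) ∈ V := by
  by_contra! hcon
  obtain ⟨v, hv⟩ := hne
  obtain ⟨f, hf0, hf1, hf01⟩ := exists_continuous_zero_one_of_isClosed
    (s := Vᶜ) (t := {v}) hV.isClosed_compl isClosed_singleton (by simpa using hv)
  let g : C(UnitAddTorus ι, ℂ) := ⟨fun y => (f y : ℂ), by fun_prop⟩
  have hlim := tendsto_average_rotation hθ x g
  have hz : ∀ N : ℕ, (N : ℂ)⁻¹ *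
      ∑ k ∈ Finset.range N, g (x + k • fun i => (θ i : UnitAddCircle)) = 0 := by
    intro N
    rw [Finset.sum_eq_zero, mul_zero]
    intro k _
    have : f (x + k • fun i => (θ i : UnitAddCircle)) = 0 := hf0 (hcon k)
    simp [g, this]
  simp_rw [hz] at hlim
  have hI := tendsto_nhds_unique hlim tendsto_const_nhds
  have hI' : ∫ y, f y ∂(volume : Measure (ι → UnitAddCircle)) = 0 := by
    have : ∫ y, g y ∂(volume : Measure (ι → UnitAddCircle)) =
        ((∫ y, f y ∂(volume : Measure (ι → UnitAddCircle)) : ℝ) : ℂ) := integral_complex_ofReal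
    rw [this] at hI
    exact_mod_cast hI
  have hpos : 0 < ∫ y, f y ∂(volume : Measure (ι → UnitAddCircle)) := by
    refine Continuous.integral_pos_of_hasCompactSupport_nonneg_nonzero f.continuous
      (HasCompactSupport.of_compactSpace _) (fun y => (hf01 y).1) (x := v) ?_
    rw [hf1 rfl]; simp
  exact hpos.ne' hI'

/-- Kronecker's theorem in multiplicative form. -/
lemma exists_pow_mul_near {θ : ι → ℝ}
    (hθ : ∀ (m : ι → ℤ) (k : ℤ), ∑ i, m i * θ i = k → m = 0)
    {a c : ι → ℂ} (ha : ∀ i, ‖a i‖ = 1) (hc : ∀ i, ‖c i‖ = 1) {ε : ℝ} (hε : 0 < ε) :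
    ∃ n : ℕ, ∀ i, ‖Complex.exp (2 * Real.pi * Complex.I * θ i) ^ n * a i - c i‖ < ε := by
  choose x hx using fun i => exists_toCircle_eq (ha i)
  choose y hy using fun i => exists_toCircle_eq (hc i)
  have hcont : ∀ i, Continuous fun z : UnitAddTorus ι => (AddCircle.toCircle (z i) : ℂ) :=
    fun i => continuous_subtype_val.comp (AddCircle.continuous_toCircle.comp (continuous_apply i))
  have hVo : IsOpen {z : UnitAddTorus ι | ∀ i, ‖(AddCircle.toCircle (z i) : ℂ) - c i‖ < ε} := by
    rw [Set.ofPred_forall]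
    exact isOpen_iInter_of_finite fun i =>
      isOpen_lt ((hcont i).sub continuous_const).norm continuous_const
  obtain ⟨n, hn⟩ := exists_nsmul_mem_of_isOpen hθ x hVo ⟨y, fun i => by simp [hy, hε]⟩
  refine ⟨n, fun i => ?_⟩
  have h1 := hn i
  rw [Pi.add_apply, AddCircle.toCircle_add, Circle.coe_mul, hx, Pi.smul_apply,
    AddCircle.toCircle_nsmul, Circle.coe_pow] at h1
  have h2 : (AddCircle.toCircle ((θ i : ℝ) : UnitAddCircle) : ℂ) =
      Complex.exp (2 * Real.pi * Complex.I * θ i) := by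
    rw [AddCircle.toCircle_apply_mk, Circle.coe_exp]
    congr 1
    push_cast
    ring
  rw [h2, mul_comm] at h1
  exact h1

end Kronecker

/-! ### Recurrence: from hypercyclicity to frequent hypercyclicity -/

section Recurrence

/-- The number of visits of the orbit of `x` under `f` to the set `U` before time `N`. -/
def visits {α : Type*} (f : α → α) (U : Set α) (N : ℕ) (x : α) : ℕ :=
  birkhoffSum f (U.indicator fun _ => 1) N x

variable {α : Type*} {f : α → α} {U : Set α}

lemma visits_add (M N : ℕ) (x : α) :
    visits f U (M + N) x = visits f U M x + visits f U N (f^[M] x) :=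
  birkhoffSum_add _ _ _ _ _

lemma visits_succ (N : ℕ) (x : α) :
    visits f U (N + 1) x = U.indicator (fun _ => 1) x + visits f U N (f x) :=
  birkhoffSum_succ' _ _ _ _

lemma visits_le (N : ℕ) (x : α) : visits f U N x ≤ N := by
  have : ∀ i ∈ Finset.range N, U.indicator (fun _ => 1) (f^[i] x) ≤ 1 := fun i _ =>
    Set.indicator_le_self' (fun _ _ => Nat.zero_le _) _
  simpa [visits, birkhoffSum] using Finset.sum_le_sum this

lemma visits_mono {V : Set α} (h : V ⊆ U) (N : ℕ) (x : α) : visits f V N x ≤ visits f U N x := by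
  unfold visits birkhoffSum
  exact Finset.sum_le_sum fun i _ =>
    Set.indicator_le_indicator_of_subset h (fun _ => Nat.zero_le _) (f^[i] x)

lemma visits_eq_ncard (N : ℕ) (x : α) :
    visits f U N x = ({n : ℕ | f^[n] x ∈ U} ∩ Set.Iio N).ncard := by
  classical
  have : {n : ℕ | f^[n] x ∈ U} ∩ Set.Iio N =
      ((Finset.range N).filter fun n => f^[n] x ∈ U : Finset ℕ) := by
    ext n
    simp [and_comm]
  rw [this, Set.ncard_coe_finset, Finset.card_filter]
  rfl

/-- If the orbit of every point of `G` visits `G` with frequency at most `1 / (k + 1)` up to some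
time `N ≤ M`, then every orbit does so up to a bounded error: cut it into segments of these lengths,
skipping the times spent outside `G`. -/
lemma mul_visits_le_of_forall_exists {G : Set α} {k M : ℕ}
    (hG : ∀ x ∈ G, ∃ N, 1 ≤ N ∧ N ≤ M ∧ (k + 1) * visits f G N x ≤ N) (n : ℕ) (x : α) :
    (k + 1) * visits f G n x ≤ n + (k + 1) * M := by
  induction n using Nat.strong_induction_on generalizing x with
  | _ n ih =>
    by_cases hx : x ∈ G
    · obtain ⟨N, h1, hM, hN⟩ := hG x hx
      rcases le_total n N with h | h
      · have : visits f G n x ≤ M := (visits_le n x).trans (h.trans hM)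
        nlinarith
      · obtain ⟨r, rfl⟩ := Nat.exists_eq_add_of_le h
        rw [visits_add, mul_add]
        have := ih r (by omega) (f^[N] x)
        omega
    · rcases n with _ | n
      · simp [visits]
      · rw [visits_succ, Set.indicator_of_notMem hx, zero_add]
        have := ih n (by omega) (f x)
        omega

variable [MeasurableSpace α] {m : Measure α}

lemma measurable_visits (hf : Measurable f) (hU : MeasurableSet U) (N : ℕ) :
    Measurable (visits f U N) := by
  unfold visits birkhoffSum
  exact Finset.measurable_sum _ fun i _ => (measurable_const.indicator hU).comp (hf.iterate i)

lemma lintegral_visits (hf : MeasurePreserving f m m) {G : Set α} (hG : MeasurableSet G) (n : ℕ) :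
    ∫⁻ x, (visits f G n x : ENNReal) ∂m = n * m G := by
  have : ∀ x, (visits f G n x : ENNReal) =
      ∑ i ∈ Finset.range n, G.indicator (fun _ => (1 : ENNReal)) (f^[i] x) := by
    intro x
    rw [visits, birkhoffSum, Nat.cast_sum]
    refine Finset.sum_congr rfl fun i _ => ?_
    by_cases h : f^[i] x ∈ G <;> simp [h]
  simp_rw [this]
  have hm : ∀ i, Measurable fun x => G.indicator (fun _ => (1 : ENNReal)) (f^[i] x) := fun i =>
    (measurable_const.indicator hG).comp (hf.measurable.iterate i)
  rw [lintegral_finsetSum _ fun i _ => hm i]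
  have hi : ∀ i ∈ Finset.range n,
      ∫⁻ x, G.indicator (fun _ => (1 : ENNReal)) (f^[i] x) ∂m = m G := by
    intro i _
    rw [(hf.iterate i).lintegral_comp (f := G.indicator fun _ => (1 : ENNReal))
      (measurable_const.indicator hG), lintegral_indicator_const hG, one_mul]
  rw [Finset.sum_congr rfl hi]
  simp

lemma mul_measure_le_one [IsProbabilityMeasure m]
    (hf : MeasurePreserving f m m) {G : Set α} (hGm : MeasurableSet G) {k M : ℕ}
    (hG : ∀ x ∈ G, ∃ N, 1 ≤ N ∧ N ≤ M ∧ (k + 1) * visits f G N x ≤ N) :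
    (k + 1 : ENNReal) * m G ≤ 1 := by
  have hn : ∀ n : ℕ, (k + 1 : ENNReal) * (n * m G) ≤ n + (k + 1) * M := by
    intro n
    have hm : Measurable fun x => (visits f G n x : ENNReal) :=
      measurable_from_top.comp (measurable_visits hf.measurable hGm n)
    rw [← lintegral_visits hf hGm n, ← lintegral_const_mul _ hm]
    calc ∫⁻ x, (k + 1 : ENNReal) * (visits f G n x : ENNReal) ∂m
        ≤ ∫⁻ _, ((n : ENNReal) + (k + 1) * M) ∂m := by
          refine lintegral_mono fun x => ?_
          have h : (((k + 1) * visits f G n x : ℕ) : ENNReal) ≤ ((n + (k + 1) * M : ℕ) : ENNReal) :=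
            Nat.cast_le.mpr (mul_visits_le_of_forall_exists hG n x)
          push_cast at h
          exact h
      _ = _ := by simp
  have hfin : m G ≠ ⊤ := measure_ne_top _ _
  lift m G to NNReal using hfin with p
  norm_cast at hn ⊢
  by_contra! hlt
  obtain ⟨n, hn'⟩ := exists_nat_gt (((k + 1 : ℕ) * M : NNReal) / (((k + 1 : ℕ) : NNReal) * p - 1))
  have hpos : 0 < ((k + 1 : ℕ) : NNReal) * p - 1 := tsub_pos_of_lt hlt
  rw [div_lt_iff₀ hpos, mul_tsub, mul_one] at hn'
  have h3 := hn n
  push_cast at *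
  have h4 := lt_tsub_iff_right.mp hn'
  have h5 : (n : NNReal) * ((k + 1) * p) = (k + 1) * (n * p) := by ring
  rw [h5] at h4
  exact absurd (lt_of_lt_of_le h4 h3) (by rw [add_comm]; exact lt_irrefl _)

/-- Almost every point of `U` returns to `U` with positive lower frequency. The points of `U`
whose visits up to some time `N ≤ M` have frequency at most `1 / (k + 1)` have measure at most
`1 / (k + 1)`, and every exceptional point is of this kind for each `k` and some `M`. -/
lemma ae_mem_imp_exists_le_mul_visits [IsProbabilityMeasure m]
    (hf : MeasurePreserving f m m) (hU : MeasurableSet U) :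
    ∀ᵐ x ∂m, x ∈ U → ∃ k N₀ : ℕ, ∀ N ≥ N₀, N ≤ (k + 1) * visits f U N x := by
  have hle : ∀ k : ℕ, (k + 1 : ENNReal) *
      m {x | x ∈ U ∧ ¬ ∃ k N₀ : ℕ, ∀ N ≥ N₀, N ≤ (k + 1) * visits f U N x} ≤ 1 := by
    intro k
    let G : ℕ → Set α := fun M =>
      U ∩ ⋃ N ∈ Finset.Icc 1 M, {x | (k + 1) * visits f U N x ≤ N}
    have hGm : ∀ M, MeasurableSet (G M) := fun M => hU.inter <|
      Finset.measurableSet_biUnion _ fun N _ =>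
        measurableSet_le ((measurable_visits hf.measurable hU N).const_mul _) measurable_const
    have hGmono : Monotone G := fun M M' h => Set.inter_subset_inter_right _ <|
      Set.biUnion_subset_biUnion_left fun N hN => by
        simp only [Finset.mem_coe, Finset.mem_Icc] at hN ⊢; omega
    have hsub : {x | x ∈ U ∧ ¬ ∃ k N₀ : ℕ, ∀ N ≥ N₀, N ≤ (k + 1) * visits f U N x} ⊆
        ⋃ M, G M := by
      rintro x ⟨hx, hbad⟩
      push Not at hbad
      obtain ⟨N, hN1, hN⟩ := hbad k 1
      refine Set.mem_iUnion.mpr ⟨N, hx, Set.mem_biUnion (x := N) ?_ hN.le⟩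
      simpa using hN1
    refine (mul_le_mul_right (measure_mono hsub) _).trans ?_
    rw [hGmono.measure_iUnion, ENNReal.mul_iSup]
    refine iSup_le fun M => mul_measure_le_one (M := M) hf (hGm M) fun x hx => ?_
    obtain ⟨N, hN, hx'⟩ := Set.mem_iUnion₂.mp hx.2
    rw [Finset.mem_Icc] at hN
    exact ⟨N, hN.1, hN.2, (Nat.mul_le_mul_left _ (visits_mono Set.inter_subset_left N x)).trans hx'⟩
  rw [ae_iff]
  simp only [Classical.not_imp]
  by_contra h0
  have hfin : m {x | x ∈ U ∧ ¬ ∃ k N₀ : ℕ, ∀ N ≥ N₀, N ≤ (k + 1) * visits f U N x} ≠ ⊤ :=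
    measure_ne_top _ _
  obtain ⟨k, hk⟩ := ENNReal.exists_nat_mul_gt h0 ENNReal.one_ne_top
  refine absurd (hle k) (not_le.mpr (hk.trans_le ?_))
  gcongr
  exact le_self_add

end Recurrence

lemma lowerDensity_pos {A : Set ℕ} {k N₀ : ℕ}
    (h : ∀ N ≥ N₀, N ≤ (k + 1) * (A ∩ Set.Iio N).ncard) : 0 < lowerDensity A := by
  have hk : (0 : ℝ) < 1 / (k + 1) := by positivity
  refine hk.trans_le (le_liminf_of_le ?_ ?_)
  · refine isCoboundedUnder_ge_of_le atTop (x := 1) fun N => ?_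
    refine div_le_one_of_le₀ ?_ (Nat.cast_nonneg _)
    have : (A ∩ Set.Iio N).ncard ≤ (Set.Iio N).ncard :=
      Set.ncard_le_ncard Set.inter_subset_right (Set.finite_Iio N)
    rw [← Finset.coe_Iio, Set.ncard_coe_finset, Nat.card_Iio] at this
    rw [← Finset.coe_Iio]
    exact_mod_cast this
  · filter_upwards [eventually_ge_atTop N₀, eventually_gt_atTop 0] with N hN h0
    rw [div_le_div_iff₀ (by positivity) (by exact_mod_cast h0), one_mul]
    have := h N hN
    rw [mul_comm]
    exact_mod_cast this

section FrequentHypercyclicity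

variable {X : Type*} [NormedAddCommGroup X] [NormedSpace ℂ X]

lemma pow_apply_eq_iterate (T : X →L[ℂ] X) (n : ℕ) (v : X) : (T ^ n) v = T^[n] v := by
  induction n generalizing v with
  | zero => rfl
  | succ n ih => rw [pow_succ, Function.iterate_succ_apply, ← ih]; rfl

/-- If `T` preserves a probability measure for which almost every vector is hypercyclic, then
almost every vector is frequently hypercyclic. -/
lemma ae_isFreqHypercyclicVector [SecondCountableTopology X] [MeasurableSpace X] [BorelSpace X]
    {T : X →L[ℂ] X} {m : Measure X} [IsProbabilityMeasure m] (hT : MeasurePreserving T m m)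
    (hhc : ∀ᵐ v ∂m, IsHypercyclicVector T v) : ∀ᵐ v ∂m, IsFreqHypercyclicVector T v := by
  have hrec : ∀ᵐ v ∂m, ∀ V ∈ TopologicalSpace.countableBasis X, ∀ n : ℕ,
      T^[n] v ∈ V → ∃ k N₀ : ℕ, ∀ N ≥ N₀, N ≤ (k + 1) * visits T V N (T^[n] v) := by
    rw [ae_ball_iff (TopologicalSpace.countable_countableBasis X)]
    intro V hV
    rw [ae_all_iff]
    intro n
    exact (hT.iterate n).quasiMeasurePreserving.ae
      (ae_mem_imp_exists_le_mul_visits hT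
        (TopologicalSpace.isOpen_of_mem_countableBasis hV).measurableSet)
  filter_upwards [hhc, hrec] with v hv hvr U hU ⟨u, hu⟩
  obtain ⟨V, hV, huV, hVU⟩ :=
    (TopologicalSpace.isBasis_countableBasis X).exists_subset_of_mem_open hu hU
  obtain ⟨_, hw, n, rfl⟩ :=
    hv.inter_open_nonempty V (TopologicalSpace.isOpen_of_mem_countableBasis hV) ⟨u, huV⟩
  simp only [pow_apply_eq_iterate] at hw ⊢
  obtain ⟨k, N₀, h⟩ := hvr V hV n hw
  refine lowerDensity_pos (k := 2 * k + 1) (N₀ := N₀ + 2 * n) fun N hN => ?_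
  rw [← visits_eq_ncard]
  obtain ⟨r, rfl⟩ : ∃ r, N = n + r := Nat.exists_eq_add_of_le (by omega)
  have h1 := h r (by omega)
  have h2 := visits_mono (f := T) hVU (n + r) v
  rw [visits_add] at h2
  have h3 : (k + 1) * visits T V r (T^[n] v) ≤ (k + 1) * visits T U (n + r) v :=
    Nat.mul_le_mul_left _ (by omega)
  have h4 : (2 * k + 1 + 1) * visits T U (n + r) v = 2 * ((k + 1) * visits T U (n + r) v) := by
    ring
  omega

end FrequentHypercyclicity

/-! ### Random series of eigenvectors -/

section RandomSeries

variable {X : Type*} [NormedAddCommGroup X] [NormedSpace ℂ X]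

lemma measurableSet_ofPred_forall {ι : Sort*} {α : Type*} [Countable ι] [MeasurableSpace α]
    {p : ι → α → Prop} (h : ∀ i, MeasurableSet {x | p i x}) : MeasurableSet {x | ∀ i, p i x} := by
  rw [Set.ofPred_forall]
  exact MeasurableSet.iInter h

lemma measurableSet_ofPred_exists {ι : Sort*} {α : Type*} [Countable ι] [MeasurableSpace α]
    {p : ι → α → Prop} (h : ∀ i, MeasurableSet {x | p i x}) : MeasurableSet {x | ∃ i, p i x} := by
  rw [Set.ofPred_exists]
  exact MeasurableSet.iUnion h

/-- The partial sum `∑ n < N, z n • y n` of the random series with terms `y`. -/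
def partialSum (y : ℕ → X) (N : ℕ) (z : ℕ → ℂ) : X := ∑ n ∈ Finset.range N, z n • y n

lemma continuous_partialSum (y : ℕ → X) (N : ℕ) : Continuous (partialSum y N) := by
  unfold partialSum; fun_prop

lemma pow_apply_eigenvector {T : X →L[ℂ] X} {y : X} {μ : ℂ} (h : T y = μ • y) (n : ℕ) :
    (T ^ n) y = μ ^ n • y := by
  induction n with
  | zero => simp
  | succ n ih => rw [pow_succ, mul_apply_eq_comp, h, map_smul, ih, smul_smul, pow_succ']

variable {T : X →L[ℂ] X} {y : ℕ → X} {μ : ℕ → ℂ}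

lemma pow_apply_partialSum (hy : ∀ n, T (y n) = μ n • y n) (n N : ℕ) (z : ℕ → ℂ) :
    (T ^ n) (partialSum y N z) = partialSum y N fun j => μ j ^ n * z j := by
  simp only [partialSum, map_sum, map_smul, pow_apply_eigenvector (hy _), smul_smul, mul_comm]

variable {Φ : (ℕ → ℂ) → X}

lemma pow_apply_eq_of_tendsto (hy : ∀ n, T (y n) = μ n • y n) {n : ℕ} {z : ℕ → ℂ}
    (h1 : Tendsto (fun N => partialSum y N z) atTop (𝓝 (Φ z)))
    (h2 : Tendsto (fun N => partialSum y N fun j => μ j ^ n * z j) atTop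
      (𝓝 (Φ fun j => μ j ^ n * z j))) :
    (T ^ n) (Φ z) = Φ fun j => μ j ^ n * z j := by
  refine tendsto_nhds_unique (((T ^ n).continuous.tendsto _).comp h1) ?_
  refine h2.congr fun N => ?_
  rw [Function.comp_apply, pow_apply_partialSum hy]

lemma ae_tendsto_rotate
    (hΦ : ∀ᵐ z ∂steinhausLaw, Tendsto (fun N => partialSum y N z) atTop (𝓝 (Φ z)))
    {c : ℕ → ℂ} (hc : ∀ n, ‖c n‖ = 1) :
    ∀ᵐ z ∂steinhausLaw, Tendsto (fun N => partialSum y N fun j => c j * z j) atTop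
      (𝓝 (Φ fun j => c j * z j)) :=
  (measurePreserving_rotate hc).quasiMeasurePreserving.ae hΦ

lemma partialSum_rotate_sub (n K N : ℕ) (hN : K ≤ N) (z : ℕ → ℂ) :
    partialSum y N (fun j => (if j < K then 1 else μ j ^ n) * z j) -
      partialSum y K (fun j => (if j < K then 1 else μ j ^ n) * z j) =
    partialSum y N (fun j => μ j ^ n * z j) - partialSum y K (fun j => μ j ^ n * z j) := by
  simp only [partialSum]
  rw [← Finset.sum_range_add_sum_Ico _ hN, ← Finset.sum_range_add_sum_Ico _ hN,
    add_sub_cancel_left, add_sub_cancel_left]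
  refine Finset.sum_congr rfl fun j hj => ?_
  rw [if_neg (by simpa using (Finset.mem_Ico.mp hj).1)]

variable [MeasurableSpace X] [BorelSpace X]

/-- The law of the sum of a random series of eigenvectors is invariant: `T` acts on the series by
rotating the Steinhaus variables. -/
lemma measurePreserving_law (hμ : ∀ n, ‖μ n‖ = 1) (hy : ∀ n, T (y n) = μ n • y n)
    (hΦm : Measurable Φ)
    (hΦ : ∀ᵐ z ∂steinhausLaw, Tendsto (fun N => partialSum y N z) atTop (𝓝 (Φ z))) :
    MeasurePreserving T (steinhausLaw.map Φ) (steinhausLaw.map Φ) := by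
  refine ⟨T.continuous.measurable, ?_⟩
  have hR := measurePreserving_rotate hμ
  rw [Measure.map_map T.continuous.measurable hΦm]
  conv_rhs => rw [← hR.map_eq, Measure.map_map hΦm hR.measurable]
  refine Measure.map_congr ?_
  filter_upwards [hΦ, ae_tendsto_rotate hΦ hμ] with z h1 h2
  simpa using pow_apply_eq_of_tendsto hy (n := 1) h1 (by simpa using h2)

variable [SecondCountableTopology X]

/-- Almost every sum of the random series has an orbit that meets a given ball, as soon as
the orbits of the rotation by the eigenvalues are dense in every finite-dimensional torus and the
sums `∑ j < K, c j • y j` with unimodular `c`, `K` large, are dense in `X`.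

The time `n` at which the first `K` terms of `T ^ n Φ` are close to the target depends on the first
`K` Steinhaus variables only. Rotating the remaining variables by `μ j ^ n` preserves both the law
and the event that `n` is the first such time, so `T ^ n` does not increase the probability
that the remainder of the series is large. -/
lemma ae_exists_norm_pow_sub_lt (hμ : ∀ n, ‖μ n‖ = 1) (hy : ∀ n, T (y n) = μ n • y n)
    (hK : ∀ (K : ℕ) (a c : ℕ → ℂ), (∀ j, ‖a j‖ = 1) → (∀ j, ‖c j‖ = 1) → ∀ ε > 0,
      ∃ n : ℕ, ∀ j < K, ‖μ j ^ n * a j - c j‖ < ε)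
    (hD : ∀ (u : X), ∀ ε > 0, ∀ K₀ : ℕ, ∃ K ≥ K₀, ∃ c : ℕ → ℂ, (∀ j, ‖c j‖ = 1) ∧
      ‖partialSum y K c - u‖ < ε)
    (hΦm : Measurable Φ)
    (hΦ : ∀ᵐ z ∂steinhausLaw, Tendsto (fun N => partialSum y N z) atTop (𝓝 (Φ z)))
    (u : X) {ε : ℝ} (hε : 0 < ε) :
    ∀ᵐ z ∂steinhausLaw, ∃ n : ℕ, ‖(T ^ n) (Φ z) - u‖ < ε := by
  rw [ae_iff, ← nonpos_iff_eq_zero]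
  refine ENNReal.le_of_forall_pos_le_add fun δ hδ _ => ?_
  rw [zero_add]
  have hinM := tendstoInMeasure_of_tendsto_ae
    (fun N => (continuous_partialSum y N).aestronglyMeasurable) hΦ
  have hlim := hinM (ENNReal.ofReal (ε / 3)) (by simpa using hε)
  obtain ⟨K₀, hK₀⟩ := eventually_atTop.mp
    (hlim.eventually (gt_mem_nhds (ENNReal.coe_pos.mpr hδ)))
  obtain ⟨K, hKK₀, c, hc, hcu⟩ := hD u (ε / 3) (by positivity) K₀
  set Bad : Set (ℕ → ℂ) := {z | ENNReal.ofReal (ε / 3) ≤ edist (partialSum y K z) (Φ z)}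
    with hBad
  have hBadm : MeasurableSet Bad :=
    measurableSet_le measurable_const
      (((continuous_partialSum y K).measurable).edist hΦm)
  set η : ℝ := (ε / 3) / (∑ j ∈ Finset.range K, ‖y j‖ + 1) with hη
  have hsum : 0 ≤ ∑ j ∈ Finset.range K, ‖y j‖ := Finset.sum_nonneg fun _ _ => norm_nonneg _
  have hηpos : 0 < η := by positivity
  -- `near n` says that `T ^ n` moves the first `K` terms close to the target
  let near : ℕ → (ℕ → ℂ) → Prop := fun n z => ∀ j < K, ‖μ j ^ n * z j - c j‖ < η
  have hnear : ∀ n, MeasurableSet {z | near n z} := fun n =>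
    measurableSet_ofPred_forall fun j =>
      measurableSet_ofPred_forall
        (p := fun (_ : j < K) (z : ℕ → ℂ) => ‖μ j ^ n * z j - c j‖ < η) fun _ =>
        measurableSet_lt (by fun_prop) measurable_const
  let A : ℕ → Set (ℕ → ℂ) := fun n => {z | near n z ∧ ∀ k < n, ¬ near k z}
  have hAm : ∀ n, MeasurableSet (A n) := fun n =>
    (hnear n).inter (measurableSet_ofPred_forall fun k =>
      measurableSet_ofPred_forall fun _ => (hnear k).compl)
  have hAdisj : Pairwise (Function.onFun Disjoint A) := by
    intro n k hnk
    refine Set.disjoint_left.mpr fun z hz hz' => ?_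
    rcases lt_or_gt_of_ne hnk with h | h
    · exact hz'.2 n h hz.1
    · exact hz.2 k h hz'.1
  let c' : ℕ → ℕ → ℂ := fun n j => if j < K then 1 else μ j ^ n
  have hc' : ∀ n j, ‖c' n j‖ = 1 := fun n j => by
    by_cases h : j < K <;> simp [c', h, hμ]
  let R : ℕ → (ℕ → ℂ) → ℕ → ℂ := fun n z j => c' n j * z j
  have hR : ∀ n, MeasurePreserving (R n) steinhausLaw steinhausLaw := fun n =>
    measurePreserving_rotate (hc' n)
  have hRA : ∀ n, R n ⁻¹' A n = A n := by
    intro n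
    have : ∀ k z, near k (R n z) ↔ near k z := fun k z =>
      forall₂_congr fun j hj => by simp [R, c', hj]
    ext z
    simp [A, this]
  have hcover : ∀ᵐ z ∂steinhausLaw, (¬ ∃ n : ℕ, ‖(T ^ n) (Φ z) - u‖ < ε) →
      z ∈ ⋃ n, A n ∩ R n ⁻¹' Bad := by
    have h1 : ∀ᵐ z ∂steinhausLaw, ∀ n, Tendsto (fun N => partialSum y N fun j => μ j ^ n * z j)
        atTop (𝓝 (Φ fun j => μ j ^ n * z j)) :=
      ae_all_iff.mpr fun n => ae_tendsto_rotate hΦ fun j => by rw [norm_pow, hμ, one_pow]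
    have h2 : ∀ᵐ z ∂steinhausLaw, ∀ n, Tendsto (fun N => partialSum y N (R n z))
        atTop (𝓝 (Φ (R n z))) :=
      ae_all_iff.mpr fun n => ae_tendsto_rotate hΦ (hc' n)
    filter_upwards [hΦ, h1, h2, steinhausLaw_ae_norm] with z hz hz1 hz2 hzn hno
    have hex : ∃ n, near n z := hK K z c hzn hc η hηpos
    classical
    refine Set.mem_iUnion.mpr ⟨Nat.find hex, ⟨Nat.find_spec hex, fun k hk => Nat.find_min hex hk⟩,
      ?_⟩
    set n := Nat.find hex
    have hn : near n z := Nat.find_spec hex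
    by_contra hgood
    refine hno ⟨n, ?_⟩
    have htail : Φ (R n z) - partialSum y K (R n z) =
        (T ^ n) (Φ z) - partialSum y K fun j => μ j ^ n * z j := by
      rw [pow_apply_eq_of_tendsto hy hz (hz1 n)]
      refine tendsto_nhds_unique ((hz2 n).sub_const _) (((hz1 n).sub_const _).congr' ?_)
      filter_upwards [eventually_ge_atTop K] with N hN
      exact (partialSum_rotate_sub n K N hN z).symm
    have h3 : ‖(T ^ n) (Φ z) - partialSum y K fun j => μ j ^ n * z j‖ < ε / 3 := by
      rw [← htail, ← norm_neg, neg_sub, ← dist_eq_norm]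
      simp only [hBad, Set.mem_preimage, Set.mem_ofPred_eq, not_le, edist_dist] at hgood
      exact (ENNReal.ofReal_lt_ofReal_iff (by positivity)).mp hgood
    have h4 : ‖(partialSum y K fun j => μ j ^ n * z j) - partialSum y K c‖ ≤ ε / 3 := by
      simp only [partialSum, ← Finset.sum_sub_distrib, ← sub_smul]
      calc ‖∑ j ∈ Finset.range K, (μ j ^ n * z j - c j) • y j‖
          ≤ ∑ j ∈ Finset.range K, η * ‖y j‖ := by
            refine norm_sum_le_of_le _ fun j hj => ?_
            rw [norm_smul]
            exact mul_le_mul_of_nonneg_right (hn j (Finset.mem_range.mp hj)).le (norm_nonneg _)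
        _ = η * ∑ j ∈ Finset.range K, ‖y j‖ := by rw [Finset.mul_sum]
        _ ≤ η * (∑ j ∈ Finset.range K, ‖y j‖ + 1) := by gcongr; linarith
        _ = ε / 3 := by rw [hη]; field_simp
    have h5 : (T ^ n) (Φ z) - u = ((T ^ n) (Φ z) - partialSum y K fun j => μ j ^ n * z j) +
        ((partialSum y K fun j => μ j ^ n * z j) - partialSum y K c) + (partialSum y K c - u) := by
      abel
    rw [h5]
    refine (norm_add₃_le).trans_lt ?_
    linarith
  calc steinhausLaw {z | ¬ ∃ n : ℕ, ‖(T ^ n) (Φ z) - u‖ < ε}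
      ≤ steinhausLaw (⋃ n, A n ∩ R n ⁻¹' Bad) := measure_mono_ae hcover
    _ ≤ ∑' n, steinhausLaw (A n ∩ R n ⁻¹' Bad) := measure_iUnion_le _
    _ = ∑' n, steinhausLaw (A n ∩ Bad) := by
        refine tsum_congr fun n => ?_
        rw [← (hR n).measure_preimage ((hAm n).inter hBadm).nullMeasurableSet, Set.preimage_inter,
          hRA]
    _ = steinhausLaw (⋃ n, A n ∩ Bad) := by
        rw [measure_iUnion (fun i j hij => (hAdisj hij).mono Set.inter_subset_left
          Set.inter_subset_left) fun n => (hAm n).inter hBadm]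
    _ ≤ steinhausLaw Bad := measure_mono (Set.iUnion_subset fun n => Set.inter_subset_right)
    _ ≤ δ := (hK₀ K hKK₀).le

lemma ae_isHypercyclicVector (hμ : ∀ n, ‖μ n‖ = 1) (hy : ∀ n, T (y n) = μ n • y n)
    (hK : ∀ (K : ℕ) (a c : ℕ → ℂ), (∀ j, ‖a j‖ = 1) → (∀ j, ‖c j‖ = 1) → ∀ ε > 0,
      ∃ n : ℕ, ∀ j < K, ‖μ j ^ n * a j - c j‖ < ε)
    (hD : ∀ (u : X), ∀ ε > 0, ∀ K₀ : ℕ, ∃ K ≥ K₀, ∃ c : ℕ → ℂ, (∀ j, ‖c j‖ = 1) ∧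
      ‖partialSum y K c - u‖ < ε)
    (hΦm : Measurable Φ)
    (hΦ : ∀ᵐ z ∂steinhausLaw, Tendsto (fun N => partialSum y N z) atTop (𝓝 (Φ z))) :
    ∀ᵐ v ∂(steinhausLaw.map Φ), IsHypercyclicVector T v := by
  have hall : ∀ᵐ v ∂(steinhausLaw.map Φ), ∀ k l : ℕ, ∃ n : ℕ,
      ‖(T ^ n) v - TopologicalSpace.denseSeq X k‖ < 1 / ((l : ℝ) + 1) := by
    rw [ae_map_iff hΦm.aemeasurable ?_]
    · rw [ae_all_iff]
      intro k
      rw [ae_all_iff]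
      intro l
      exact ae_exists_norm_pow_sub_lt hμ hy hK hD hΦm hΦ _ (by positivity)
    · exact measurableSet_ofPred_forall fun k => measurableSet_ofPred_forall fun l =>
        measurableSet_ofPred_exists fun n =>
        (isOpen_lt (by fun_prop) continuous_const).measurableSet
  filter_upwards [hall] with v hv
  refine Metric.dense_iff.mpr fun u r hr => ?_
  obtain ⟨l, hl⟩ := exists_nat_one_div_lt (half_pos hr)
  obtain ⟨k, hk⟩ :=
    (TopologicalSpace.denseRange_denseSeq X).exists_dist_lt u (half_pos hr)
  obtain ⟨n, hn⟩ := hv k l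
  refine ⟨(T ^ n) v, ?_, n, rfl⟩
  rw [Metric.mem_ball]
  rw [← dist_eq_norm] at hn
  rw [dist_comm] at hk
  linarith [dist_triangle ((T ^ n) v) (TopologicalSpace.denseSeq X k) u]

end RandomSeries

/-! ### Finite blocks of vectors -/

section Blocks

variable {X : Type*} [NormedAddCommGroup X]

/-- The sequence of vectors which starts with the entries of a finite list and continues by `0`. -/
def blockSeq (B : List X) (l : ℕ) : X := B.getD l 0

lemma blockSeq_append_left (B₁ B₂ : List X) {l : ℕ} (h : l < B₁.length) :
    blockSeq (B₁ ++ B₂) l = blockSeq B₁ l :=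
  List.getD_append _ _ _ _ h

lemma blockSeq_append_right (B₁ B₂ : List X) (l : ℕ) :
    blockSeq (B₁ ++ B₂) (B₁.length + l) = blockSeq B₂ l := by
  rw [blockSeq, List.getD_append_right _ _ _ _ (Nat.le_add_right _ _), Nat.add_sub_cancel_left,
    blockSeq]

variable [NormedSpace ℂ X]

/-- The mean, for independent Steinhaus variables `z l`, of the largest norm of a partial sum of
the series `∑ l, z l • w l`. -/
def meanMaximal (w : ℕ → X) : ENNReal :=
  ∫⁻ z, ⨆ m, ‖partialSum w m z‖ₑ ∂steinhausLaw

lemma measurable_iSup_enorm_partialSum (w : ℕ → X) :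
    Measurable fun z : ℕ → ℂ => ⨆ m, ‖partialSum w m z‖ₑ :=
  Measurable.iSup fun m => (continuous_partialSum w m).enorm.measurable

lemma lintegral_iSup_shift (w : ℕ → X) (k : ℕ) :
    ∫⁻ z, ⨆ m, ‖partialSum w m fun l => z (k + l)‖ₑ ∂steinhausLaw = meanMaximal w :=
  (measurePreserving_shift k).lintegral_comp (measurable_iSup_enorm_partialSum w)

lemma partialSum_add (y : ℕ → X) (M N : ℕ) (z : ℕ → ℂ) :
    partialSum y (M + N) z =
      partialSum y M z + partialSum (fun l => y (M + l)) N fun l => z (M + l) :=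
  Finset.sum_range_add _ _ _

lemma partialSum_congr {y y' : ℕ → X} {z z' : ℕ → ℂ} {N : ℕ} (hy : ∀ l < N, y l = y' l)
    (hz : ∀ l < N, z l = z' l) : partialSum y N z = partialSum y' N z' :=
  Finset.sum_congr rfl fun l hl => by
    rw [hy l (Finset.mem_range.mp hl), hz l (Finset.mem_range.mp hl)]

lemma partialSum_blockSeq_append_of_le (B₁ B₂ : List X) {m : ℕ} (hm : m ≤ B₁.length) (z : ℕ → ℂ) :
    partialSum (blockSeq (B₁ ++ B₂)) m z = partialSum (blockSeq B₁) m z :=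
  partialSum_congr (fun _ hl => blockSeq_append_left _ _ (hl.trans_le hm)) fun _ _ => rfl

lemma partialSum_blockSeq_append (B₁ B₂ : List X) (m : ℕ) (z : ℕ → ℂ) :
    partialSum (blockSeq (B₁ ++ B₂)) (B₁.length + m) z =
      partialSum (blockSeq B₁) B₁.length z +
        partialSum (blockSeq B₂) m fun l => z (B₁.length + l) := by
  rw [partialSum_add, partialSum_blockSeq_append_of_le _ _ le_rfl]
  congr 1
  exact partialSum_congr (fun l _ => blockSeq_append_right _ _ l) fun _ _ => rfl

lemma meanMaximal_append_le (B₁ B₂ : List X) :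
    meanMaximal (blockSeq (B₁ ++ B₂)) ≤ meanMaximal (blockSeq B₁) + meanMaximal (blockSeq B₂) := by
  rw [← lintegral_iSup_shift (blockSeq B₂) B₁.length, meanMaximal, meanMaximal,
    ← lintegral_add_left (measurable_iSup_enorm_partialSum _)]
  refine lintegral_mono fun z => iSup_le fun m => ?_
  rcases le_total m B₁.length with h | h
  · rw [partialSum_blockSeq_append_of_le _ _ h]
    exact (le_iSup (fun m => ‖partialSum (blockSeq B₁) m z‖ₑ) m).trans le_self_add
  · obtain ⟨r, rfl⟩ := Nat.exists_eq_add_of_le h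
    rw [partialSum_blockSeq_append]
    refine (enorm_add_le _ _).trans (add_le_add ?_ ?_)
    · exact le_iSup (fun m => ‖partialSum (blockSeq B₁) m z‖ₑ) _
    · exact le_iSup (fun m => ‖partialSum (blockSeq B₂) m fun l => z (B₁.length + l)‖ₑ) _

lemma sum_range_sum_range (f : ℕ → ℝ) (N : ℕ) :
    ∑ m ∈ Finset.range (N + 1), ∑ l ∈ Finset.range m, f l =
      ∑ l ∈ Finset.range N, ((N : ℝ) - l) * f l := by
  induction N with
  | zero => simp
  | succ N ih =>
    rw [Finset.sum_range_succ, ih, Finset.sum_range_succ, Finset.sum_range_succ (n := N),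
      ← add_assoc, ← Finset.sum_add_distrib]
    push_cast
    congr 1
    · exact Finset.sum_congr rfl fun l _ => by ring
    · ring

/-- There are finite convex weights for which even the sum of the variances of all partial sums of
`∑ l, z l * a l` is small. The weights `a l` proportional to `1 / (N - l)` do: this sum of variances
is then the inverse of the `N`-th harmonic number. -/
lemma exists_weights {ε : ℝ} (hε : 0 < ε) :
    ∃ (N : ℕ) (a : ℕ → ℝ), 0 < N ∧ (∀ l < N, 0 < a l) ∧ ∑ l ∈ Finset.range N, a l = 1 ∧
      ∑ m ∈ Finset.range (N + 1), ∑ l ∈ Finset.range m, a l ^ 2 ≤ ε := by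
  obtain ⟨N, hN⟩ := ((tendsto_atTop.mp
    Real.tendsto_sum_range_one_div_nat_succ_atTop (max 1 ε⁻¹))).exists
  set H : ℝ := ∑ i ∈ Finset.range N, 1 / ((i : ℝ) + 1) with hH
  have hH1 : 1 ≤ H := (le_max_left _ _).trans hN
  have hHpos : 0 < H := by linarith
  have hrefl : ∑ l ∈ Finset.range N, 1 / ((N : ℝ) - l) = H := by
    rw [hH, ← Finset.sum_range_reflect]
    refine Finset.sum_congr rfl fun l hl => ?_
    have hl' : l < N := Finset.mem_range.mp hl
    rw [Nat.sub_sub, Nat.cast_sub (by omega)]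
    push_cast
    congr 1
    ring
  have hpos : ∀ l < N, (0 : ℝ) < (N : ℝ) - l := fun l hl => by
    have : (l : ℝ) < N := by exact_mod_cast hl
    linarith
  refine ⟨N, fun l => 1 / ((N : ℝ) - l) / H, ?_, fun l hl => ?_, ?_, ?_⟩
  · rcases Nat.eq_zero_or_pos N with rfl | h
    · simp [hH] at hH1
      linarith
    · exact h
  · have := hpos l hl
    positivity
  · rw [← Finset.sum_div, hrefl, div_self hHpos.ne']
  · rw [sum_range_sum_range]
    have : ∀ l ∈ Finset.range N, ((N : ℝ) - l) * (1 / ((N : ℝ) - l) / H) ^ 2 =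
        1 / ((N : ℝ) - l) * (H⁻¹ ^ 2) := by
      intro l hl
      have := hpos l (Finset.mem_range.mp hl)
      field_simp
    rw [Finset.sum_congr rfl this, ← Finset.sum_mul, hrefl]
    have h2 : H * H⁻¹ ^ 2 = H⁻¹ := by field_simp
    rw [h2]
    exact inv_le_of_inv_le₀ hε ((le_max_right _ _).trans hN)

/-- Vectors `(b * a l) • x l`, `l < N`, with `x l` close to a fixed unit vector have a small mean
maximal partial sum if the weights `a l` are as in `exists_weights`. -/
lemma meanMaximal_run_le {e : X} (he : ‖e‖ = 1) {x : ℕ → X} {a : ℕ → ℝ} {N : ℕ} {b δ η : ℝ}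
    (hb : 0 ≤ b) (hδ : 0 ≤ δ) (hη : 0 < η) (ha : ∀ l < N, 0 < a l)
    (hsum : ∑ l ∈ Finset.range N, a l = 1)
    (hvar : ∑ m ∈ Finset.range (N + 1), ∑ l ∈ Finset.range m, a l ^ 2 ≤ η ^ 2)
    (hx : ∀ l < N, ‖x l - e‖ ≤ δ) :
    meanMaximal (blockSeq ((List.range N).map fun l => ((b * a l : ℝ) : ℂ) • x l)) ≤
      ENNReal.ofReal (b * (2 * η + δ)) := by
  set w := blockSeq ((List.range N).map fun l => ((b * a l : ℝ) : ℂ) • x l) with hw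
  have hw1 : ∀ l < N, w l = ((b * a l : ℝ) : ℂ) • x l := fun l hl => by
    simp [hw, blockSeq, hl]
  have hw2 : ∀ l, N ≤ l → w l = 0 := fun l hl => by
    simp [hw, blockSeq, hl]
  let σ : ℕ → (ℕ → ℂ) → ℂ := fun m z => ∑ l ∈ Finset.range m, z l * (a l : ℂ)
  let V : (ℕ → ℂ) → ℝ := fun z => ∑ m ∈ Finset.range (N + 1), ‖σ m z‖ ^ 2
  have hσ : ∀ m, Continuous (σ m) := fun m => by fun_prop
  have hσint : ∀ m, Integrable (fun z => ‖σ m z‖ ^ 2) steinhausLaw := fun m => by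
    refine Integrable.of_bound (C := (∑ l ∈ Finset.range m, |a l|) ^ 2)
      ((hσ m).norm.pow 2).aestronglyMeasurable ?_
    filter_upwards [steinhausLaw_ae_norm] with z hz
    rw [Real.norm_of_nonneg (by positivity)]
    gcongr
    refine norm_sum_le_of_le _ fun l _ => ?_
    simp [hz]
  have hVint : Integrable V steinhausLaw := integrable_finsetSum _ fun m _ => hσint m
  have hVle : ∫ z, V z ∂steinhausLaw ≤ η ^ 2 := by
    simp only [V]
    rw [integral_finsetSum _ fun m _ => hσint m]
    simpa only [σ, integral_normSq_sum_steinhausLaw] using hvar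
  have hbound : ∀ z : ℕ → ℂ, (∀ n, ‖z n‖ = 1) → ∀ m ≤ N,
      ‖partialSum w m z‖ ≤ b * (η + δ + η⁻¹ * V z) := by
    intro z hz m hm
    have h1 : partialSum w m z = ((b : ℂ) * σ m z) • e +
        ∑ l ∈ Finset.range m, (z l * ((b * a l : ℝ) : ℂ)) • (x l - e) := by
      simp only [partialSum, σ, Finset.mul_sum, Finset.sum_smul, ← Finset.sum_add_distrib]
      refine Finset.sum_congr rfl fun l hl => ?_
      rw [hw1 l ((Finset.mem_range.mp hl).trans_le hm), smul_sub, smul_smul]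
      have : (b : ℂ) * (z l * (a l : ℂ)) = z l * ((b * a l : ℝ) : ℂ) := by push_cast; ring
      rw [this]
      abel
    have h2 : ‖∑ l ∈ Finset.range m, (z l * ((b * a l : ℝ) : ℂ)) • (x l - e)‖ ≤ b * δ := by
      calc _ ≤ ∑ l ∈ Finset.range m, b * a l * δ := by
            refine norm_sum_le_of_le _ fun l hl => ?_
            have hlN : l < N := (Finset.mem_range.mp hl).trans_le hm
            have hal := ha l hlN
            rw [norm_smul, norm_mul, hz, one_mul, Complex.norm_real,
              Real.norm_of_nonneg (by positivity)]
            exact mul_le_mul_of_nonneg_left (hx l hlN) (by positivity)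
        _ ≤ ∑ l ∈ Finset.range N, b * a l * δ := by
            refine Finset.sum_le_sum_of_subset_of_nonneg
              (Finset.range_subset_range.mpr hm) fun l hl _ => ?_
            have hal := ha l (Finset.mem_range.mp hl)
            positivity
        _ = b * δ := by rw [← Finset.sum_mul, ← Finset.mul_sum, hsum, mul_one]
    -- `V` dominates the square of every partial sum, and `r ≤ η + r ^ 2 / η` is linear in `V`
    have h3 : ‖σ m z‖ ≤ η + η⁻¹ * V z := by
      have h4 : ‖σ m z‖ ^ 2 ≤ V z :=
        Finset.single_le_sum (f := fun m => ‖σ m z‖ ^ 2) (fun m _ => by positivity)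
          (Finset.mem_range.mpr (Nat.lt_succ_of_le hm))
      have h5 : ‖σ m z‖ ≤ η + η⁻¹ * ‖σ m z‖ ^ 2 := by
        have h6 : η + η⁻¹ * ‖σ m z‖ ^ 2 - ‖σ m z‖ =
            η⁻¹ * ((‖σ m z‖ - η / 2) ^ 2 + 3 / 4 * η ^ 2) := by field_simp; ring
        have h7 : 0 ≤ η⁻¹ * ((‖σ m z‖ - η / 2) ^ 2 + 3 / 4 * η ^ 2) := by positivity
        linarith
      have h8 : η⁻¹ * ‖σ m z‖ ^ 2 ≤ η⁻¹ * V z := by gcongr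
      linarith
    calc ‖partialSum w m z‖ ≤ ‖((b : ℂ) * σ m z) • e‖ + b * δ := by
          rw [h1]; exact (norm_add_le _ _).trans (by linarith)
      _ = b * ‖σ m z‖ + b * δ := by
          rw [norm_smul, he, mul_one, norm_mul, Complex.norm_real, Real.norm_of_nonneg hb]
      _ ≤ b * (η + η⁻¹ * V z) + b * δ := by gcongr
      _ = b * (η + δ + η⁻¹ * V z) := by ring
  have hVnn : ∀ z, 0 ≤ V z := fun z => Finset.sum_nonneg fun _ _ => by positivity
  have hg : Integrable (fun z => b * (η + δ + η⁻¹ * V z)) steinhausLaw :=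
    ((integrable_const _).add (hVint.const_mul _)).const_mul _
  calc meanMaximal w ≤ ∫⁻ z, ENNReal.ofReal (b * (η + δ + η⁻¹ * V z)) ∂steinhausLaw := by
        refine lintegral_mono_ae ?_
        filter_upwards [steinhausLaw_ae_norm] with z hz
        refine iSup_le fun m => ?_
        have hmin : partialSum w m z = partialSum w (min m N) z := by
          rcases le_total m N with h | h
          · rw [min_eq_left h]
          · rw [min_eq_right h]
            obtain ⟨r, rfl⟩ := Nat.exists_eq_add_of_le h
            rw [partialSum_add, add_eq_left]
            refine Finset.sum_eq_zero fun l _ => ?_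
            simp only [hw2 _ (Nat.le_add_right N l), smul_zero]
        rw [hmin, ← ofReal_norm]
        exact ENNReal.ofReal_le_ofReal (hbound z hz _ (min_le_right _ _))
    _ = ENNReal.ofReal (∫ z, b * (η + δ + η⁻¹ * V z) ∂steinhausLaw) :=
        (ofReal_integral_eq_lintegral_ofReal hg
          (Eventually.of_forall fun z => by have := hVnn z; positivity)).symm
    _ ≤ ENNReal.ofReal (b * (2 * η + δ)) := by
        refine ENNReal.ofReal_le_ofReal ?_
        rw [integral_const_mul, integral_add (integrable_const _) (hVint.const_mul _),
          integral_const_mul]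
        simp only [integral_const, probReal_univ, one_smul]
        have : η⁻¹ * ∫ z, V z ∂steinhausLaw ≤ η := by
          calc η⁻¹ * ∫ z, V z ∂steinhausLaw ≤ η⁻¹ * η ^ 2 := by gcongr
            _ = η := by field_simp
        exact mul_le_mul_of_nonneg_left (by linarith) hb

end Blocks

/-! ### Approximation by blocks of eigenvectors -/

section Approximation

variable {X : Type*} [NormedAddCommGroup X] [NormedSpace ℂ X]

/-- The vector `α • x n` coded by a pair `(n, α)`. -/
def codedVector (x : ℕ → X) (p : ℕ × ℝ) : X := (p.2 : ℂ) • x p.1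

/-- A list of pairs `(n, α)`, standing for the vectors `α • x n`, is a block avoiding `F` of size
at most `ε` if the coefficients are positive, the eigenvalues are distinct and outside `F`,
and the mean maximal partial sum of the corresponding random sum is at most `ε`. -/
structure IsBlock (x : ℕ → X) (lam : ℕ → ℂ) (F : Set ℂ) (ε : ℝ) (B : List (ℕ × ℝ)) : Prop where
  pos : ∀ p ∈ B, 0 < p.2
  nodup : (B.map fun p => lam p.1).Nodup
  notMem : ∀ p ∈ B, lam p.1 ∉ F
  meanMaximal_le : meanMaximal (blockSeq (B.map (codedVector x))) ≤ ENNReal.ofReal ε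

/-- The vector `u` is a limit of unimodular combinations of nonempty blocks of arbitrarily small
size avoiding any given finite set of eigenvalues. -/
def BlockApproximable (x : ℕ → X) (lam : ℕ → ℂ) (u : X) : Prop :=
  ∀ ε > 0, ∀ F : Set ℂ, F.Finite → ∃ B : List (ℕ × ℝ), B ≠ [] ∧ IsBlock x lam F ε B ∧
    ∃ c : ℕ → ℂ, (∀ j, ‖c j‖ = 1) ∧
      ‖partialSum (blockSeq (B.map (codedVector x))) B.length c - u‖ ≤ ε

variable {x : ℕ → X} {lam : ℕ → ℂ}

lemma IsBlock.mono {F : Set ℂ} {ε ε' : ℝ} {B : List (ℕ × ℝ)} (h : IsBlock x lam F ε B)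
    (hε : ε ≤ ε') : IsBlock x lam F ε' B :=
  ⟨h.pos, h.nodup, h.notMem, h.meanMaximal_le.trans (ENNReal.ofReal_le_ofReal hε)⟩

lemma BlockApproximable.of_forall_near {u : X}
    (h : ∀ ε > 0, ∃ v, BlockApproximable x lam v ∧ ‖v - u‖ ≤ ε) : BlockApproximable x lam u := by
  intro ε hε F hF
  obtain ⟨v, hv, hvu⟩ := h (ε / 2) (by positivity)
  obtain ⟨B, hne, hB, c, hc, hcv⟩ := hv (ε / 2) (by positivity) F hF
  refine ⟨B, hne, hB.mono (by linarith), c, hc, ?_⟩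
  calc _ ≤ ‖partialSum (blockSeq (B.map (codedVector x))) B.length c - v‖ + ‖v - u‖ :=
        norm_sub_le_norm_sub_add_norm_sub _ _ _
    _ ≤ ε := by linarith

lemma BlockApproximable.add {u v : X} (hu : BlockApproximable x lam u)
    (hv : BlockApproximable x lam v) : BlockApproximable x lam (u + v) := by
  intro ε hε F hF
  obtain ⟨B₁, hne₁, hB₁, c₁, hc₁, hcu⟩ := hu (ε / 2) (by positivity) F hF
  obtain ⟨B₂, hne₂, hB₂, c₂, hc₂, hcv⟩ := hv (ε / 2) (by positivity)
    (F ∪ {w | w ∈ B₁.map fun p => lam p.1}) (hF.union (List.finite_toSet _))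
  refine ⟨B₁ ++ B₂, by simp [hne₁], ⟨?_, ?_, ?_, ?_⟩,
    fun j => if j < B₁.length then c₁ j else c₂ (j - B₁.length), fun j => ?_, ?_⟩
  · intro p hp
    rcases List.mem_append.mp hp with h | h
    exacts [hB₁.pos p h, hB₂.pos p h]
  · rw [List.map_append]
    refine List.nodup_append'.mpr ⟨hB₁.nodup, hB₂.nodup, fun w hw hw' => ?_⟩
    obtain ⟨p, hp, rfl⟩ := List.mem_map.mp hw'
    exact hB₂.notMem p hp (Or.inr hw)
  · intro p hp
    rcases List.mem_append.mp hp with h | h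
    exacts [hB₁.notMem p h, fun h' => hB₂.notMem p h (Or.inl h')]
  · rw [List.map_append]
    refine (meanMaximal_append_le _ _).trans
      ((add_le_add hB₁.meanMaximal_le hB₂.meanMaximal_le).trans ?_)
    rw [← ENNReal.ofReal_add (by positivity) (by positivity), add_halves]
  · dsimp only
    split_ifs
    exacts [hc₁ _, hc₂ _]
  · have h := partialSum_blockSeq_append (B₁.map (codedVector x)) (B₂.map (codedVector x))
      B₂.length fun j => if j < B₁.length then c₁ j else c₂ (j - B₁.length)
    rw [List.length_map] at h
    rw [List.map_append, List.length_append, h]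
    have h1 : partialSum (blockSeq (B₁.map (codedVector x))) B₁.length
        (fun j => if j < B₁.length then c₁ j else c₂ (j - B₁.length)) =
        partialSum (blockSeq (B₁.map (codedVector x))) B₁.length c₁ :=
      partialSum_congr (fun _ _ => rfl) fun l hl => if_pos hl
    have h2 : partialSum (blockSeq (B₂.map (codedVector x))) B₂.length
        (fun l => (fun j => if j < B₁.length then c₁ j else c₂ (j - B₁.length)) (B₁.length + l)) =
        partialSum (blockSeq (B₂.map (codedVector x))) B₂.length c₂ :=
      partialSum_congr (fun _ _ => rfl) fun l _ => by simp
    rw [h1, h2, add_sub_add_comm]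
    exact (norm_add_le _ _).trans (by linarith)

variable {T : X →L[ℂ] X} {θ : ℕ → ℝ}

lemma SatisfiesHWith.lam_mem (h : SatisfiesHWith T x lam θ) (n : ℕ) :
    lam n ∈ unimodularPointSpectrum T :=
  ⟨(h.eigenvector n).1, Module.End.hasEigenvalue_of_hasEigenvector (h.eigenvector n).2⟩

/-- Every `x i` is a limit of vectors `x n` with distinct eigenvalues outside a given finite set. -/
lemma SatisfiesHWith.exists_near (h : SatisfiesHWith T x lam θ) (i : ℕ) {F : Set ℂ}
    (hF : F.Finite) {δ : ℝ} (hδ : 0 < δ) :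
    ∃ g : ℕ → ℕ, Function.Injective (fun l => lam (g l)) ∧ (∀ l, lam (g l) ∉ F) ∧
      ∀ l, ‖x (g l) - x i‖ ≤ δ := by
  classical
  obtain ⟨g, hg, hne⟩ := exists_seq_of_forall_finset_exists
    (fun n => lam n ∉ F ∧ ‖x n - x i‖ ≤ δ) (fun m n => lam m ≠ lam n) fun s _ => by
      have hfin : ((F ∪ lam '' s) ∩ unimodularPointSpectrum T).Finite :=
        (hF.union (s.finite_toSet.image _)).inter_of_left _
      have hcl : x i ∈ closure (x '' {n | lam n ∉ (F ∪ lam '' s) ∩ unimodularPointSpectrum T}) := by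
        rw [← h.approx _ hfin Set.inter_subset_right]
        exact subset_closure ⟨i, rfl⟩
      obtain ⟨_, ⟨n, hn, rfl⟩, hd⟩ := Metric.mem_closure_iff.mp hcl δ hδ
      have hn' : lam n ∉ F ∪ lam '' s := fun h' => hn ⟨h', h.lam_mem n⟩
      refine ⟨n, ⟨fun h' => hn' (Or.inl h'), ?_⟩, fun m hm heq => hn' (Or.inr ⟨m, hm, heq⟩)⟩
      rw [← dist_eq_norm, dist_comm]
      exact hd.le
  refine ⟨g, fun k l hkl => ?_, fun l => (hg l).1, fun l => (hg l).2⟩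
  rcases lt_trichotomy k l with hlt | rfl | hlt
  · exact absurd hkl (hne _ _ hlt)
  · rfl
  · exact absurd hkl.symm (hne _ _ hlt)

/-- Nonzero multiples of `x i` are block approximable: `b • x i` is split into many small
pieces, each placed on an eigenvector close to `x i` with an eigenvalue of its own. -/
lemma SatisfiesHWith.blockApproximable_smul_of_ne_zero (h : SatisfiesHWith T x lam θ) (i : ℕ)
    {b : ℂ} (hb : b ≠ 0) : BlockApproximable x lam (b • x i) := by
  intro ε hε F hF
  have hbn : 0 < ‖b‖ := norm_pos_iff.mpr hb
  set η : ℝ := ε / (3 * ‖b‖) with hη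
  have hηpos : 0 < η := by positivity
  have hbη : ‖b‖ * (2 * η + η) = ε := by rw [hη]; field_simp; ring
  obtain ⟨N, a, hN, ha, hsum, hvar⟩ := exists_weights (ε := η ^ 2) (by positivity)
  obtain ⟨g, hinj, hgF, hgx⟩ := h.exists_near i hF hηpos
  set B : List (ℕ × ℝ) := (List.range N).map fun l => (g l, ‖b‖ * a l) with hB
  have hBx : B.map (codedVector x) =
      (List.range N).map fun l => ((‖b‖ * a l : ℝ) : ℂ) • x (g l) := by
    simp [hB, codedVector, Function.comp_def]
  refine ⟨B, ?_, ⟨?_, ?_, ?_, ?_⟩, fun _ => b / ‖b‖, fun _ => ?_, ?_⟩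
  · simpa [hB] using hN.ne'
  · intro p hp
    obtain ⟨l, hl, rfl⟩ := List.mem_map.mp hp
    exact mul_pos hbn (ha l (List.mem_range.mp hl))
  · rw [hB, List.map_map]
    exact List.Nodup.map hinj List.nodup_range
  · intro p hp
    obtain ⟨l, hl, rfl⟩ := List.mem_map.mp hp
    exact hgF l
  · rw [hBx]
    refine (meanMaximal_run_le (h.norm_one i) hbn.le hηpos.le hηpos ha hsum hvar
      fun l _ => hgx l).trans_eq ?_
    rw [hbη]
  · rw [norm_div, Complex.norm_real, norm_norm, div_self hbn.ne']
  · have hlen : B.length = N := by simp [hB]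
    have hbc : (‖b‖ : ℂ) ≠ 0 := by exact_mod_cast hbn.ne'
    have hsumc : (∑ l ∈ Finset.range N, (a l : ℂ)) = 1 := by exact_mod_cast hsum
    have h1 : partialSum (blockSeq (B.map (codedVector x))) B.length (fun _ => b / ‖b‖) - b • x i =
        ∑ l ∈ Finset.range N, (b * (a l : ℂ)) • (x (g l) - x i) := by
      have h2 : b • x i = ∑ l ∈ Finset.range N, (b * (a l : ℂ)) • x i := by
        rw [← Finset.sum_smul, ← Finset.mul_sum, hsumc, mul_one]
      rw [h2, hlen, hBx, partialSum, ← Finset.sum_sub_distrib]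
      refine Finset.sum_congr rfl fun l hl => ?_
      have h3 : blockSeq ((List.range N).map fun l => ((‖b‖ * a l : ℝ) : ℂ) • x (g l)) l =
          ((‖b‖ * a l : ℝ) : ℂ) • x (g l) := by
        simp [blockSeq, Finset.mem_range.mp hl]
      rw [h3, smul_smul, smul_sub]
      congr 2
      push_cast
      field_simp
    rw [h1]
    calc _ ≤ ∑ l ∈ Finset.range N, ‖b‖ * a l * η := by
          refine norm_sum_le_of_le _ fun l hl => ?_
          have hal := ha l (Finset.mem_range.mp hl)
          rw [norm_smul, norm_mul, Complex.norm_real, Real.norm_of_nonneg hal.le]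
          exact mul_le_mul_of_nonneg_left (hgx l) (by positivity)
      _ = ‖b‖ * η := by rw [← Finset.sum_mul, ← Finset.mul_sum, hsum, mul_one]
      _ ≤ ε := by rw [← hbη]; gcongr; linarith

lemma SatisfiesHWith.blockApproximable_smul (h : SatisfiesHWith T x lam θ) (i : ℕ) (b : ℂ) :
    BlockApproximable x lam (b • x i) := by
  by_cases hb : b = 0
  · subst hb
    refine BlockApproximable.of_forall_near fun ε hε => ⟨(ε : ℂ) • x i,
      h.blockApproximable_smul_of_ne_zero i (by exact_mod_cast hε.ne'), ?_⟩
    rw [zero_smul, sub_zero, norm_smul, h.norm_one, mul_one, Complex.norm_real,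
      Real.norm_of_nonneg hε.le]
  · exact h.blockApproximable_smul_of_ne_zero i hb

lemma SatisfiesHWith.blockApproximable (h : SatisfiesHWith T x lam θ) (u : X) :
    BlockApproximable x lam u := by
  have hzero : BlockApproximable x lam (0 : X) := by
    simpa using h.blockApproximable_smul 0 0
  have hspan : ∀ v ∈ Submodule.span ℂ (Set.range x), BlockApproximable x lam v := by
    intro v hv
    obtain ⟨c, rfl⟩ := (Finsupp.mem_span_range_iff_exists_finsupp).mp hv
    rw [Finsupp.sum]
    refine Finset.sum_induction _ (BlockApproximable x lam) (fun _ _ => .add) hzero fun i _ =>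
      h.blockApproximable_smul i _
  refine BlockApproximable.of_forall_near fun ε hε => ?_
  obtain ⟨v, hv, hd⟩ := h.spanning.exists_dist_lt u hε
  refine ⟨v, hspan v hv, ?_⟩
  rw [← dist_eq_norm, dist_comm]
  exact hd.le

/-- There is a finite set of eigenvalues off which `1` and the arguments of distinct eigenvalues are
rationally independent. There is at most one rational relation between `1` and the arguments
up to scaling, and the eigenvalues occurring in one such relation form the desired set. -/
lemma SatisfiesHWith.exists_finite_independent (h : SatisfiesHWith T x lam θ) :
    ∃ F : Set ℂ, F.Finite ∧ ∀ (s : Finset ℕ), Set.InjOn lam s → (∀ n ∈ s, lam n ∉ F) →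
      ∀ (m : ℕ → ℤ) (k : ℤ), ∑ n ∈ s, m n * θ n = k → ∀ n ∈ s, m n = 0 := by
  classical
  have hind : ∀ s : Finset ℕ, Set.InjOn lam s → ∀ m : ℕ → ℤ, ∑ n ∈ s, m n * θ n = 0 →
      ∀ n ∈ s, m n = 0 := by
    intro s hs m hm n hn
    have hli := Fintype.linearIndependent_iff.mp (h.independent s hs).2 (fun n => (m n : ℚ)) (by
      rw [← hm, ← Finset.sum_coe_sort s]
      refine Finset.sum_congr rfl fun n _ => ?_
      rw [Rat.smul_def, Rat.cast_intCast]) ⟨n, hn⟩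
    exact_mod_cast hli
  by_cases hrel : ∀ s : Finset ℕ, Set.InjOn lam s →
      ∀ (m : ℕ → ℤ) (k : ℤ), ∑ n ∈ s, m n * θ n = k → ∀ n ∈ s, m n = 0
  · exact ⟨∅, Set.finite_empty, fun s hs _ => hrel s hs⟩
  push Not at hrel
  obtain ⟨s₀, hs₀, m₀, k₀, hk₀, n₀, hn₀, hm₀⟩ := hrel
  have hk₀ne : k₀ ≠ 0 := by
    rintro rfl
    exact hm₀ (hind s₀ hs₀ m₀ (by simpa using hk₀) n₀ hn₀)
  refine ⟨lam '' s₀, s₀.finite_toSet.image _, fun s hs hsF m k hk n hn => ?_⟩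
  have hdisj : ∀ n ∈ s, n ∉ s₀ := fun n hn hn' => hsF n hn ⟨n, hn', rfl⟩
  have hdisj' : Disjoint s s₀ := Finset.disjoint_left.mpr hdisj
  have hinj : Set.InjOn lam (s ∪ s₀ : Finset ℕ) := by
    intro p hp q hq hpq
    rw [Finset.mem_coe, Finset.mem_union] at hp hq
    rcases hp with hp | hp <;> rcases hq with hq | hq
    · exact hs hp hq hpq
    · exact absurd ⟨q, hq, hpq.symm⟩ (hsF p hp)
    · exact absurd ⟨p, hp, hpq⟩ (hsF q hq)
    · exact hs₀ hp hq hpq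
  have h0 := hind (s ∪ s₀) hinj (fun n => if n ∈ s₀ then -(k * m₀ n) else k₀ * m n) (by
    rw [Finset.sum_union hdisj']
    have e1 : ∑ n ∈ s, ((if n ∈ s₀ then -(k * m₀ n) else k₀ * m n : ℤ) : ℝ) * θ n = k₀ * k := by
      rw [← hk, Finset.mul_sum]
      refine Finset.sum_congr rfl fun n hn => ?_
      rw [if_neg (hdisj n hn)]
      push_cast
      ring
    have e2 : ∑ n ∈ s₀, ((if n ∈ s₀ then -(k * m₀ n) else k₀ * m n : ℤ) : ℝ) * θ n =
        -(k * k₀) := by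
      rw [← hk₀, Finset.mul_sum, ← Finset.sum_neg_distrib]
      refine Finset.sum_congr rfl fun n hn => ?_
      rw [if_pos hn]
      push_cast
      ring
    rw [e1, e2]
    ring) n (Finset.mem_union_left _ hn)
  rw [if_neg (hdisj n hn)] at h0
  exact (mul_eq_zero.mp h0).resolve_left hk₀ne

end Approximation

/-! ### Concatenation of blocks -/

section Concatenation

/-- A sequence converges if its oscillation on `[t k, t (k + 1)]` is summable in `k`. -/
lemma exists_tendsto_of_edist_le {E : Type*} [PseudoEMetricSpace E] [CompleteSpace E] {S : ℕ → E}
    {t : ℕ → ℕ} (ht : StrictMono t) (ht0 : t 0 = 0) {M : ℕ → ENNReal} (hM : ∑' k, M k ≠ ⊤)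
    (h : ∀ k n, t k ≤ n → n ≤ t (k + 1) → edist (S n) (S (t k)) ≤ M k) :
    ∃ v, Tendsto S atTop (𝓝 v) := by
  have hc : CauchySeq fun k => S (t k) := cauchySeq_of_edist_le_of_tsum_ne_top M (fun k => by
    rw [edist_comm]
    exact h k _ (ht.monotone k.le_succ) le_rfl) hM
  obtain ⟨v, hv⟩ := cauchySeq_tendsto_of_complete hc
  refine ⟨v, tendsto_iff_edist_tendsto_0.mpr ?_⟩
  -- `κ n` is the index of the interval containing `n`
  let κ : ℕ → ℕ := fun n => Nat.findGreatest (fun k => t k ≤ n) n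
  have hκ1 : ∀ n, t (κ n) ≤ n := fun n =>
    Nat.findGreatest_spec (P := fun k => t k ≤ n) (Nat.zero_le n) (by simp [ht0])
  have hκ2 : ∀ n, n ≤ t (κ n + 1) := fun n => by
    by_contra! hlt
    have := Nat.le_findGreatest (P := fun k => t k ≤ n) ((ht.le_apply).trans hlt.le) hlt.le
    exact absurd this (by simp [κ])
  have hκ : Tendsto κ atTop atTop := tendsto_atTop.mpr fun k => by
    filter_upwards [eventually_ge_atTop (t k)] with n hn
    exact Nat.le_findGreatest (ht.le_apply.trans hn) hn
  have hlim : Tendsto (fun k => M k + edist (S (t k)) v) atTop (𝓝 0) := by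
    simpa using (ENNReal.tendsto_atTop_zero_of_tsum_ne_top hM).add
      (tendsto_iff_edist_tendsto_0.mp hv)
  refine tendsto_of_tendsto_of_tendsto_of_le_of_le tendsto_const_nhds (hlim.comp hκ)
    (fun _ => zero_le) fun n => ?_
  exact (edist_triangle _ (S (t (κ n))) _).trans
    (add_le_add_left (h _ n (hκ1 n) (hκ2 n)) _)

/-- The concatenation of the first `k` blocks, where `next L k` is the `k`-th block when the
preceding ones concatenate to `L`. -/
def concatBlocks {α : Type*} (next : List α → ℕ → List α) : ℕ → List α
  | 0 => []
  | k + 1 => concatBlocks next k ++ next (concatBlocks next k) k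

variable {α : Type*} {next : List α → ℕ → List α}

lemma concatBlocks_prefix {k l : ℕ} (h : k ≤ l) :
    concatBlocks next k <+: concatBlocks next l := by
  induction l, h using Nat.le_induction with
  | base => exact List.prefix_rfl
  | succ l _ ih => exact ih.trans (List.prefix_append _ _)

lemma strictMono_length_concatBlocks (hne : ∀ L k, next L k ≠ []) :
    StrictMono fun k => (concatBlocks next k).length :=
  strictMono_nat_of_lt_succ fun k => by
    simp only [concatBlocks, List.length_append]
    have := List.length_pos_iff.mpr (hne (concatBlocks next k) k)
    omega

/-- The infinite sequence whose initial segments are the lists `concatBlocks next k`. -/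
lemma exists_seq_concatBlocks (hne : ∀ L k, next L k ≠ []) :
    ∃ s : ℕ → α, ∀ k n, n < (concatBlocks next k).length →
      (concatBlocks next k)[n]? = some (s n) := by
  have hlen : ∀ n, n < (concatBlocks next (n + 1)).length := fun n =>
    (strictMono_length_concatBlocks hne).le_apply (x := n + 1)
  refine ⟨fun n => (concatBlocks next (n + 1))[n]'(hlen n), fun k n hn => ?_⟩
  rw [← List.getElem?_eq_getElem (hlen n)]
  rcases le_total k (n + 1) with h | h
  · obtain ⟨r, hr⟩ := concatBlocks_prefix (next := next) h
    rw [← hr, List.getElem?_append_left hn]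
  · obtain ⟨r, hr⟩ := concatBlocks_prefix (next := next) h
    rw [← hr, List.getElem?_append_left (hlen n)]

end Concatenation

/-! ### The random eigenvector series of an operator satisfying (H) -/

section Construction

variable {X : Type*} [NormedAddCommGroup X] [NormedSpace ℂ X]
variable {T : X →L[ℂ] X} {x : ℕ → X} {lam : ℕ → ℂ} {θ : ℕ → ℝ}

/-- The eigenvector series obtained by concatenating blocks: the eigenvalues are distinct and
avoid `F`, the series with Steinhaus coefficients converges almost surely, and its partial sums
with unimodular coefficients are dense. The `k`-th block approximates the difference between
the `k`-th target and the sum of all preceding terms. -/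
lemma SatisfiesHWith.exists_series [CompleteSpace X] [TopologicalSpace.SeparableSpace X]
    (h : SatisfiesHWith T x lam θ) {F : Set ℂ} (hF : F.Finite) :
    ∃ s : ℕ → ℕ × ℝ, (∀ n, 0 < (s n).2) ∧ (Function.Injective fun n => lam (s n).1) ∧
      (∀ n, lam (s n).1 ∉ F) ∧
      (∀ᵐ z ∂steinhausLaw, ∃ v, Tendsto (fun N => partialSum (fun n => codedVector x (s n)) N z)
        atTop (𝓝 v)) ∧
      ∀ (u : X), ∀ ε > 0, ∀ K₀ : ℕ, ∃ K ≥ K₀, ∃ c : ℕ → ℂ, (∀ j, ‖c j‖ = 1) ∧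
        ‖partialSum (fun n => codedVector x (s n)) K c - u‖ < ε := by
  have : Nonempty X := ⟨0⟩
  let target : List (ℕ × ℝ) → ℕ → X := fun L k =>
    TopologicalSpace.denseSeq X k.unpair.1 -
      partialSum (blockSeq (L.map (codedVector x))) L.length fun _ => 1
  have hstep : ∀ (L : List (ℕ × ℝ)) (k : ℕ), ∃ B : List (ℕ × ℝ), B ≠ [] ∧
      IsBlock x lam (F ∪ {w | w ∈ L.map fun p => lam p.1}) ((1 / 2) ^ k) B ∧
      ∃ c : ℕ → ℂ, (∀ j, ‖c j‖ = 1) ∧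
        ‖partialSum (blockSeq (B.map (codedVector x))) B.length c - target L k‖ ≤ (1 / 2) ^ k :=
    fun L k => h.blockApproximable (target L k) _ (by positivity) _
      (hF.union (List.finite_toSet _))
  choose next hne hblock c hc hcu using hstep
  set L := concatBlocks next with hL
  have hLsucc : ∀ k, L (k + 1) = L k ++ next (L k) k := fun k => rfl
  obtain ⟨s, hs⟩ := exists_seq_concatBlocks hne
  let t : ℕ → ℕ := fun k => (L k).length
  have ht : StrictMono t := strictMono_length_concatBlocks hne
  have htsucc : ∀ k, t (k + 1) = t k + (next (L k) k).length := fun k => by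
    simp [t, hLsucc]
  have hmem : ∀ n, s n ∈ L (n + 1) := fun n =>
    List.mem_of_getElem? (hs (n + 1) n (ht.le_apply (x := n + 1)))
  have hpos : ∀ k, ∀ p ∈ L k, 0 < p.2 := by
    intro k
    induction k with
    | zero => simp [hL, concatBlocks]
    | succ k ih =>
      intro p hp
      rw [hLsucc, List.mem_append] at hp
      exact hp.elim (ih p) ((hblock _ _).pos p)
  have hnotF : ∀ k, ∀ p ∈ L k, lam p.1 ∉ F := by
    intro k
    induction k with
    | zero => simp [hL, concatBlocks]
    | succ k ih =>
      intro p hp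
      rw [hLsucc, List.mem_append] at hp
      exact hp.elim (ih p) fun hp' hF' => (hblock _ _).notMem p hp' (Or.inl hF')
  have hnodup : ∀ k, ((L k).map fun p => lam p.1).Nodup := by
    intro k
    induction k with
    | zero => simp [hL, concatBlocks]
    | succ k ih =>
      rw [hLsucc, List.map_append]
      refine List.nodup_append'.mpr ⟨ih, (hblock _ _).nodup, fun w hw hw' => ?_⟩
      obtain ⟨p, hp, rfl⟩ := List.mem_map.mp hw'
      exact (hblock _ _).notMem p hp (Or.inr hw)
  set y : ℕ → X := fun n => codedVector x (s n) with hy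
  have hyL : ∀ k, ∀ n < t k, y n = blockSeq ((L k).map (codedVector x)) n := by
    intro k n hn
    simp [blockSeq, List.getD_eq_getElem?_getD, List.getElem?_map, hL, hs k n hn, hy]
  have hyB : ∀ k, ∀ l < (next (L k) k).length,
      y (t k + l) = blockSeq ((next (L k) k).map (codedVector x)) l := by
    intro k l hl
    rw [hyL (k + 1) _ (by rw [htsucc]; omega), hLsucc, List.map_append]
    have := blockSeq_append_right ((L k).map (codedVector x))
      ((next (L k) k).map (codedVector x)) l
    rwa [List.length_map] at this
  have hsumB : ∀ k m, m ≤ (next (L k) k).length → ∀ z : ℕ → ℂ, partialSum y (t k + m) z =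
      partialSum y (t k) z +
        partialSum (blockSeq ((next (L k) k).map (codedVector x))) m fun l => z (t k + l) := by
    intro k m hm z
    rw [partialSum_add]
    congr 1
    exact partialSum_congr (fun l hl => hyB k l (hl.trans_le hm)) fun _ _ => rfl
  refine ⟨s, fun n => hpos _ _ (hmem n), ?_, fun n => hnotF _ _ (hmem n), ?_, ?_⟩
  · intro m n hmn
    have hm : m < (L (max m n + 1)).length :=
      lt_of_lt_of_le (by omega) (ht.le_apply (x := max m n + 1))
    have hn : n < (L (max m n + 1)).length :=
      lt_of_lt_of_le (by omega) (ht.le_apply (x := max m n + 1))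
    have e : ((L (max m n + 1)).map fun p => lam p.1)[m]? =
        ((L (max m n + 1)).map fun p => lam p.1)[n]? := by
      rw [List.getElem?_map, List.getElem?_map, hL, hs _ _ hm, hs _ _ hn]
      simpa using hmn
    exact (List.getElem?_inj (by simpa using hm) (hnodup _)).mp e
  · let M : ℕ → (ℕ → ℂ) → ENNReal := fun k z =>
      ⨆ m, ‖partialSum (blockSeq ((next (L k) k).map (codedVector x))) m fun l => z (t k + l)‖ₑ
    have hMm : ∀ k, Measurable (M k) := fun k =>
      (measurable_iSup_enorm_partialSum _).comp (measurePreserving_shift (t k)).measurable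
    have hMint : ∫⁻ z, ∑' k, M k z ∂steinhausLaw ≠ ⊤ := by
      rw [lintegral_tsum fun k => (hMm k).aemeasurable]
      refine ne_top_of_le_ne_top ?_
        (ENNReal.tsum_le_tsum (g := fun k => ENNReal.ofReal ((1 / 2) ^ k)) fun k => ?_)
      · rw [← ENNReal.ofReal_tsum_of_nonneg (fun _ => by positivity) summable_geometric_two]
        exact ENNReal.ofReal_ne_top
      · simp only [M]
        rw [lintegral_iSup_shift]
        exact (hblock (L k) k).meanMaximal_le
    filter_upwards [ae_lt_top (Measurable.tsum hMm) hMint] with z hz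
    refine exists_tendsto_of_edist_le ht rfl hz.ne fun k n h1 h2 => ?_
    obtain ⟨m, rfl⟩ := Nat.exists_eq_add_of_le h1
    rw [htsucc] at h2
    rw [hsumB k m (by omega), edist_eq_enorm_sub, add_sub_cancel_left]
    exact le_iSup (fun m => ‖partialSum (blockSeq ((next (L k) k).map (codedVector x))) m
      fun l => z (t k + l)‖ₑ) m
  · intro u ε hε K₀
    obtain ⟨i, hi⟩ := (TopologicalSpace.denseRange_denseSeq X).exists_dist_lt u (half_pos hε)
    obtain ⟨j₀, hj₀⟩ := exists_pow_lt_of_lt_one (half_pos hε) (one_half_lt_one (α := ℝ))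
    -- the target `i` is treated at every step `Nat.pair i j`
    set j := max j₀ K₀
    set k := Nat.pair i j with hk
    have hjk : j ≤ k := Nat.right_le_pair i j
    have hkt : k ≤ t (k + 1) := (Nat.le_succ k).trans ht.le_apply
    let c' : ℕ → ℂ := fun l => if l < t k then 1 else c (L k) k (l - t k)
    refine ⟨t (k + 1), (le_max_right j₀ K₀).trans (hjk.trans hkt), c', fun l => ?_, ?_⟩
    · simp only [c']
      split_ifs
      · simp
      · exact hc _ _ _
    · have e1 : partialSum y (t k) c' =
          partialSum (blockSeq ((L k).map (codedVector x))) (L k).length fun _ => 1 :=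
        partialSum_congr (hyL k) fun l hl => if_pos hl
      have e2 : (fun l => c' (t k + l)) = c (L k) k := by
        ext l
        simp [c']
      rw [htsucc, hsumB k _ le_rfl, e1, e2]
      have h1 := hcu (L k) k
      have h2 : ((1 : ℝ) / 2) ^ k ≤ (1 / 2) ^ j₀ :=
        pow_le_pow_of_le_one (by norm_num) (by norm_num) ((le_max_left j₀ K₀).trans hjk)
      simp only [target, hk, Nat.unpair_pair] at h1
      rw [← hk] at h1
      rw [dist_comm, dist_eq_norm] at hi
      set P := partialSum (blockSeq ((L k).map (codedVector x))) (L k).length fun _ => 1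
      set Q := partialSum (blockSeq ((next (L k) k).map (codedVector x))) (next (L k) k).length
        (c (L k) k)
      have e3 : P + Q - u = (Q - (TopologicalSpace.denseSeq X i - P)) +
          (TopologicalSpace.denseSeq X i - u) := by abel
      rw [e3]
      exact (norm_add_le _ _).trans_lt (by linarith)

/-- A random vector `∑ n, z n • y n` with unimodular eigenvectors `y n` whose law is invariant and
is carried by the hypercyclic vectors. -/
lemma SatisfiesH.exists_random_vector [CompleteSpace X] [SecondCountableTopology X]
    [MeasurableSpace X] [BorelSpace X] (hH : SatisfiesH T) :
    ∃ (y : ℕ → X) (μ : ℕ → ℂ) (Φ : (ℕ → ℂ) → X), (∀ n, IsUnimodularEigenvector T (μ n) (y n)) ∧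
      Measurable Φ ∧
      (∀ᵐ z ∂steinhausLaw, Tendsto (fun N => partialSum y N z) atTop (𝓝 (Φ z))) ∧
      MeasurePreserving T (steinhausLaw.map Φ) (steinhausLaw.map Φ) ∧
      ∀ᵐ v ∂(steinhausLaw.map Φ), IsHypercyclicVector T v := by
  obtain ⟨x, lam, θ, h⟩ := hH
  obtain ⟨F, hF, hind⟩ := h.exists_finite_independent
  obtain ⟨s, hs0, hsinj, hsF, hconv, hD⟩ := h.exists_series hF
  set y : ℕ → X := fun n => codedVector x (s n) with hy
  set μ : ℕ → ℂ := fun n => lam (s n).1 with hμ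
  have hμ1 : ∀ n, ‖μ n‖ = 1 := fun n => (h.eigenvector _).1
  have hyT : ∀ n, T (y n) = μ n • y n := fun n => by
    have h1 : T (x (s n).1) = lam (s n).1 • x (s n).1 := (h.eigenvector (s n).1).2.apply_eq_smul
    simp only [hy, hμ, codedVector, map_smul, h1]
    rw [smul_comm]
  have hy0 : ∀ n, y n ≠ 0 := fun n =>
    smul_ne_zero (by exact_mod_cast (hs0 n).ne') (h.eigenvector (s n).1).2.2
  have hK : ∀ (K : ℕ) (a c : ℕ → ℂ), (∀ j, ‖a j‖ = 1) → (∀ j, ‖c j‖ = 1) → ∀ ε > 0,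
      ∃ n : ℕ, ∀ j < K, ‖μ j ^ n * a j - c j‖ < ε := by
    intro K a c ha hc ε hε
    have hsi : Function.Injective fun j : Fin K => (s j).1 := fun i j hij =>
      Fin.ext (hsinj (congrArg lam hij))
    obtain ⟨n, hn⟩ := exists_pow_mul_near (θ := fun j : Fin K => θ (s j).1)
      (a := fun j => a j) (c := fun j => c j) (fun m k hmk => by
        let σ : Finset ℕ := Finset.univ.map ⟨fun j : Fin K => (s j).1, hsi⟩
        have hext : ∀ j : Fin K, Function.extend (fun j : Fin K => (s j).1) m 0 (s j).1 = m j :=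
          fun j => hsi.extend_apply m 0 j
        have h0 := hind σ ?_ ?_ (Function.extend (fun j : Fin K => (s j).1) m 0) k ?_
        · ext j
          rw [← hext j]
          exact h0 _ (Finset.mem_map.mpr ⟨j, Finset.mem_univ j, rfl⟩)
        · intro p hp q hq hpq
          obtain ⟨i, _, rfl⟩ := Finset.mem_map.mp hp
          obtain ⟨j, _, rfl⟩ := Finset.mem_map.mp hq
          exact congrArg (fun n => (s n).1) (hsinj hpq)
        · intro p hp
          obtain ⟨i, _, rfl⟩ := Finset.mem_map.mp hp
          exact hsF i
        · rw [← hmk, Finset.sum_map]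
          refine Finset.sum_congr rfl fun j _ => ?_
          simp only [Function.Embedding.coeFn_mk, hext])
      (fun j => ha j) (fun j => hc j) hε
    refine ⟨n, fun j hj => ?_⟩
    have := hn ⟨j, hj⟩
    simpa only [hμ, h.eigenvalue_eq] using this
  obtain ⟨Φ₀, hΦm, hΦ⟩ := measurable_limit_of_tendsto_metrizable_ae
    (fun N => (continuous_partialSum y N).measurable.aemeasurable) hconv
  exact ⟨y, μ, Φ₀, fun n => ⟨hμ1 n, Module.End.hasEigenvector_iff.mpr
    ⟨Module.End.mem_eigenspace_iff.mpr (hyT n), hy0 n⟩⟩, hΦm, hΦ,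
    measurePreserving_law hμ1 hyT hΦm hΦ, ae_isHypercyclicVector hμ1 hyT hK hD hΦm hΦ⟩

end Construction

end LinDyn

end

theorem theorem2p3 {X : Type*} [NormedAddCommGroup X] [NormedSpace ℂ X] [CompleteSpace X]
    [TopologicalSpace.SeparableSpace X] [MeasurableSpace X] [BorelSpace X]
    (hX : ¬ FiniteDimensional ℂ X) (T : X →L[ℂ] X)
    (hT : LinDyn.IsHypercyclic T) (hH : LinDyn.SatisfiesH T) :
    LinDyn.IsFreqHypercyclic T ∧
    ∃ (y : ℕ → X) (μ : ℕ → ℂ), (∀ n, LinDyn.IsUnimodularEigenvector T (μ n) (y n)) ∧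
      ∀ (Ω : Type*) [MeasurableSpace Ω] (P : Measure Ω) [IsProbabilityMeasure P]
        (χ : ℕ → Ω → ℂ), LinDyn.IsSteinhausSequence P χ →
        ∃ Φ : Ω → X, Measurable Φ ∧
          (∀ᵐ ω ∂P, Tendsto (fun N : ℕ => ∑ n ∈ Finset.range N, χ n ω • y n)
            atTop (𝓝 (Φ ω))) ∧
          MeasurePreserving T (P.map Φ) (P.map Φ) ∧
          ∀ᵐ v ∂(P.map Φ), LinDyn.IsHypercyclicVector T v := by
  have : SecondCountableTopology X := UniformSpace.secondCountable_of_separable X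
  obtain ⟨y, μ, Φ₀, hy, hΦm, hΦ, hinv, hhc⟩ := hH.exists_random_vector
  have : IsProbabilityMeasure (LinDyn.steinhausLaw.map Φ₀) :=
    Measure.isProbabilityMeasure_map hΦm.aemeasurable
  refine ⟨(LinDyn.ae_isFreqHypercyclicVector hinv hhc).exists, y, μ, hy, ?_⟩
  intro Ω _ P _ χ hχ
  have hχm : Measurable fun ω n => χ n ω := measurable_pi_lambda _ hχ.measurable
  have hlaw : P.map (fun ω => Φ₀ fun n => χ n ω) = LinDyn.steinhausLaw.map Φ₀ := by
    rw [← hχ.map_eq, Measure.map_map hΦm hχm]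
    rfl
  refine ⟨fun ω => Φ₀ fun n => χ n ω, hΦm.comp hχm, ?_, ?_, ?_⟩
  · rw [← hχ.map_eq] at hΦ
    exact ae_of_ae_map hχm.aemeasurable hΦ
  · rwa [hlaw]
  · rwa [hlaw]
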